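/- **Theorem 6.2 (Existence of ground states).** Let $\mathcal G$ be a metric graph with finite sets $\mathcal V$ of vertices and $\mathcal B$ of edges (self-loops and multiple edges allowed), each edge $e$ being identified with an interval $I_e=[0,\ell_e]$, $\ell_e\in[0,+\infty]$ (with $I_e=[0,+\infty)$ if $\ell_e=+\infty$). The edges of infinite length, called halflines, are those ending at a vertex at infinity; every vertex at infinity has degree one, and no edge connects two of them. Assume that $\mathcal G$ is noncompact, i.e. that it contains at least one halfline. Let $H^1(\mathcal G)$ be the set of all $u=(u_e)_{e\in\mathcal B}$, $u_e:I_e\to\mathbb C$, that are continuous on $\mathcal G$ (on every edge, and at every vertex not at infinity) and satisfy $u_e\in H^1(I_e)$ for all $e$. For $p\in(2,6)$ and $\mu>0$ put $$E(u,\mathcal G)=\frac12\sum_{e\in\mathcal B}\int_{I_e}|u_e'|^2\,dx-\frac1p\sum_{e\in\mathcal B}\int_{I_e}|u_e|^p\,dx,\qquad H^1_\mu(\mathcal G)=\Big\{u\in H^1(\mathcal G):\ \sum_{e\in\mathcal B}\int_{I_e}|u_e|^2\,dx=\mu\Big\}.$$ Let $\phi_\mu(x)=C\mu^{\frac2{6-p}}\,\mathrm{sech}^{\frac2{p-2}}\big(c\,\mu^{\frac{p-2}{6-p}}x\big)$,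 $x\in\mathbb R$, be the soliton of mass $\mu$ on the line, where $$C=\Big(\frac p2\Big)^{\frac1{p-2}}K^{\frac2{6-p}},\qquad c=\frac{p-2}2K^{\frac{p-2}{6-p}},\qquad K=\frac{\frac{p-2}2\left(\frac2p\right)^{\frac2{p-2}}}{\int_{\mathbb R}\mathrm{sech}^{\frac4{p-2}}(x)\,dx},$$ and let $E(\phi_\mu,\mathbb R)=\frac12\int_{\mathbb R}|\phi_\mu'|^2\,dx-\frac1p\int_{\mathbb R}|\phi_\mu|^p\,dx$. If $$\inf_{v\in H^1_\mu(\mathcal G)}E(v,\mathcal G)<E(\phi_\mu,\mathbb R),$$ then the infimum is attained, i.e. there is a ground state at mass $\mu$: some $u\in H^1_\mu(\mathcal G)$ with $E(u,\mathcal G)=\inf_{v\in H^1_\mu(\mathcal G)}E(v,\mathcal G)$. -/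

import Mathlib

open MeasureTheory Set
open scoped ENNReal ContDiff

noncomputable section

/-- A metric graph with vertex set `V` and edge set `E` (both are taken finite where the graph is
used); self-loops and multiple edges are allowed. The edge `e` is identified with the interval
`[0, length e]` (with `[0, ∞)` if `length e = ∞`), the point `0` being attached to `src e` and the
endpoint `length e` to `tgt e`. The halflines are the edges that end at a vertex at infinity; they
are parametrized starting from their finite vertex. -/
structure MetricGraph (V E : Type*) where
  src : E → V
  tgt : E → V
  length : E → ℝ≥0∞
  /-- the set of vertices at infinity -/
  infVerts : Set V
  /-- no edge starts at infinity; in particular two vertices at infinity are never connected -/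
  src_notMem : ∀ e, src e ∉ infVerts
  /-- the edges of infinite length are exactly the halflines -/
  length_eq_top_iff : ∀ e, length e = ⊤ ↔ tgt e ∈ infVerts
  /-- every vertex at infinity has degree one -/
  existsUnique_tgt : ∀ v ∈ infVerts, ∃! e, tgt e = v

/-- `g` is a weak derivative of `f` on the interval `I`: integration by parts holds against all
smooth functions with compact support in the interior of `I`. -/
def HasWeakDerivOn (f g : ℝ → ℂ) (I : Set ℝ) : Prop :=
  ∀ η : ℝ → ℝ, ContDiff ℝ ∞ η → HasCompactSupport η → tsupport η ⊆ interior I →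
    ∫ x in I, deriv η x • f x = -∫ x in I, η x • g x

namespace MetricGraph

variable {V E : Type*}

/-- A graph is noncompact if it contains at least one halfline. -/
def Noncompact (G : MetricGraph V E) : Prop := ∃ e, G.tgt e ∈ G.infVerts

/-- The interval `I_e`: it is `[0, length e]` if `length e < ∞`, and `[0, ∞)` otherwise. -/
def interval (G : MetricGraph V E) (e : E) : Set ℝ :=
  {x | 0 ≤ x ∧ ENNReal.ofReal x ≤ G.length e}

/-- The space `H¹(G)`: continuous functions `u = (u_e)` on the graph (continuity at the vertices
included) with `u_e ∈ H¹(I_e)` for every edge. Of `u_e : ℝ → ℂ` only the values on `I_e` matter.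
The weak derivative `u'`, unique up to null sets, is carried along. -/
structure H1 (G : MetricGraph V E) where
  toFun : E → ℝ → ℂ
  /-- the weak derivative `u'` -/
  der : E → ℝ → ℂ
  continuousOn : ∀ e, ContinuousOn (toFun e) (G.interval e)
  /-- the value attained at a vertex is independent of the edge chosen to reach it -/
  continuous_vertex : ∃ c : V → ℂ, ∀ e, toFun e 0 = c (G.src e) ∧
    (G.length e ≠ ⊤ → toFun e (G.length e).toReal = c (G.tgt e))
  memLp : ∀ e, MemLp (toFun e) 2 (volume.restrict (G.interval e))
  memLp_der : ∀ e, MemLp (der e) 2 (volume.restrict (G.interval e))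
  hasWeakDeriv : ∀ e, HasWeakDerivOn (toFun e) (der e) (G.interval e)

variable [Fintype E]

/-- The mass `‖u‖²` in `L²(G)`. -/
def mass {G : MetricGraph V E} (u : G.H1) : ℝ :=
  ∑ e, ∫ x in G.interval e, ‖u.toFun e x‖ ^ 2

/-- The NLS energy `E(u, G) = ½ ‖u'‖² - (1/p) ‖u‖_p^p`. -/
def energy (p : ℝ) {G : MetricGraph V E} (u : G.H1) : ℝ :=
  (1 / 2) * (∑ e, ∫ x in G.interval e, ‖u.der e x‖ ^ 2) -
    (1 / p) * (∑ e, ∫ x in G.interval e, ‖u.toFun e x‖ ^ p)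

/-- The space `H¹_μ(G)` of the functions in `H¹(G)` of mass `μ`. -/
def H1mu (G : MetricGraph V E) (μ : ℝ) : Set G.H1 := {u | mass u = μ}

/-- The infimum of the energy `E(·, G)` over `H¹_μ(G)`, in the extended reals. -/
def groundEnergy (G : MetricGraph V E) (p μ : ℝ) : EReal :=
  ⨅ v ∈ G.H1mu μ, (energy p v : EReal)

/-- `u` is a ground state at mass `μ`: it belongs to `H¹_μ(G)` and attains the infimum there. -/
def IsGroundState (G : MetricGraph V E) (p μ : ℝ) (u : G.H1) : Prop :=
  u ∈ G.H1mu μ ∧ (energy p u : EReal) = G.groundEnergy p μ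

end MetricGraph

/-- The normalization factor of the soliton, depending on `p` only:
`((p - 2) / 2) (2 / p) ^ (2 / (p - 2)) / ∫ sech ^ (4 / (p - 2))`. -/
def solitonK (p : ℝ) : ℝ :=
  (p - 2) / 2 * (2 / p) ^ (2 / (p - 2)) / ∫ x : ℝ, (1 / Real.cosh x) ^ (4 / (p - 2))

/-- The amplitude constant of the soliton. -/
def solitonAmp (p : ℝ) : ℝ := (p / 2) ^ (1 / (p - 2)) * solitonK p ^ (2 / (6 - p))

/-- The inverse width constant of the soliton. -/
def solitonFreq (p : ℝ) : ℝ := (p - 2) / 2 * solitonK p ^ ((p - 2) / (6 - p))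

/-- The soliton of mass `μ` on the line,
`φ_μ(x) = C μ^{2/(6-p)} sech^{2/(p-2)} (c μ^{(p-2)/(6-p)} x)`. The constants `C = solitonAmp p` and
`c = solitonFreq p` are the ones for which `φ_μ` has mass `μ` and solves `φ'' + φ^{p-1} = ω φ` with
`ω = (solitonK p * μ) ^ (2 (p - 2) / (6 - p))`. -/
def soliton (p μ : ℝ) (x : ℝ) : ℝ :=
  solitonAmp p * μ ^ (2 / (6 - p)) *
    (1 / Real.cosh (solitonFreq p * μ ^ ((p - 2) / (6 - p)) * x)) ^ (2 / (p - 2))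

/-- The energy `E(φ_μ, ℝ)` of the soliton on the line. -/
def solitonEnergy (p μ : ℝ) : ℝ :=
  (1 / 2) * (∫ x : ℝ, |deriv (soliton p μ) x| ^ 2) - (1 / p) * ∫ x : ℝ, |soliton p μ x| ^ p

end

open Filter Topology

/-! The proof is a concentration-compactness argument. Along a minimizing sequence the kinetic term
stays bounded, because for `p < 6` the potential term is controlled by a power of it smaller than
one (`exists_energy_ge`). A subsequence then converges weakly to some `v` (`exists_subseq_tendsto`).
On bounded parts of the graph the squared modulus and its `p`-th power converge in integral, so mass
can be lost only along the halflines. Lost mass costs at least as much energy as on the line: with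
`m` the mass of `v` and `I` the infimum, E(v) + lineLevel(μ - m) ≤ I (`energy_add_lineLevel_le`). If
0 < m < μ, rescaling `v` to mass `μ` gives E(v) ≥ (m/μ) I, since `p > 2` (`mul_le_energy`); for m =
0 this just says E(v) ≥ 0. Moreover I < E(φ_μ) = lineLevel(μ) (`solitonEnergy_eq`) and
`mul_lineLevel_le` give lineLevel(μ - m) > ((μ - m)/μ) I. The sum exceeds I, a contradiction. Hence
m = μ, and E(v) ≤ I.

The cost of escaping is estimated by a calibration, without rearrangements
(`lineLevel_sub_le_tail`). Let M be the maximum of |u| over the tails of the halflines beyond R, W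
the `solitonSlope` of height M and S its primitive `solitonAction`. The tail energy plus M^(p-2)/p
times the tail mass is the integral of ½|u'|² + ½W(|u|)² ≥ W(|u|)|u'|, which bounds the variation of
S(|u|). On a halfline where M is attained, |u| reaches M from |u(R)| and then decays to 0, so the
integral is at least 2S(M) - S(|u(R)|); the other halflines contribute nonnegative amounts.
Computing S(M) along the soliton of height M and applying Young's inequality gives 2S(M) - M^(p-2)
m/p ≥ lineLevel(m) for every M (`lineLevel_le`). The boundary term is of order |u(R)|², and vanishes
when the sequence index and then R go to infinity. -/

/-! ### Powers of the hyperbolic secant -/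

/-- The integral of `sech ^ r` over the positive halfline. -/
noncomputable def sechInt (r : ℝ) : ℝ := ∫ x in Ioi (0 : ℝ), (1 / Real.cosh x) ^ r

lemma sech_pos (x : ℝ) : 0 < 1 / Real.cosh x := one_div_pos.2 (Real.cosh_pos x)

lemma hasDerivAt_tanh' (x : ℝ) : HasDerivAt Real.tanh ((1 / Real.cosh x) ^ 2) x := by
  have h := (Real.hasDerivAt_sinh x).div (Real.hasDerivAt_cosh x) (Real.cosh_pos x).ne'
  have e : Real.tanh = fun y => Real.sinh y / Real.cosh y := by
    ext y; exact Real.tanh_eq_sinh_div_cosh y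
  rw [e]
  refine h.congr_deriv ?_
  have := Real.cosh_sq x
  have h0 := (Real.cosh_pos x).ne'
  field_simp
  linarith

lemma tanh_sq_eq (x : ℝ) : Real.tanh x ^ 2 = 1 - (1 / Real.cosh x) ^ 2 := by
  rw [Real.tanh_eq_sinh_div_cosh]
  have := Real.cosh_sq x
  have h0 := (Real.cosh_pos x).ne'
  field_simp
  linarith

lemma hasDerivAt_sech_rpow (q x : ℝ) :
    HasDerivAt (fun y => (1 / Real.cosh y) ^ q)
      (-q * (1 / Real.cosh x) ^ q * Real.tanh x) x := by
  have h0 := (Real.cosh_pos x).ne'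
  have h1 : HasDerivAt (fun y => 1 / Real.cosh y) (-Real.sinh x / Real.cosh x ^ 2) x := by
    simpa [one_div] using (Real.hasDerivAt_cosh x).fun_inv h0
  have h2 := h1.rpow_const (p := q) (Or.inl (sech_pos x).ne')
  refine h2.congr_deriv ?_
  rw [Real.rpow_sub_one (sech_pos x).ne', Real.tanh_eq_sinh_div_cosh]
  field_simp

lemma continuous_sech_rpow (r : ℝ) : Continuous fun x => (1 / Real.cosh x) ^ r :=
  continuous_iff_continuousAt.2 fun x => (hasDerivAt_sech_rpow r x).continuousAt

lemma sech_rpow_le {r : ℝ} (hr : 0 < r) (x : ℝ) :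
    (1 / Real.cosh x) ^ r ≤ 2 ^ r * Real.exp (-r * x) := by
  have h : 1 / Real.cosh x ≤ 2 * Real.exp (-x) := by
    rw [div_le_iff₀ (Real.cosh_pos x), Real.cosh_eq]
    have h1 : Real.exp (-x) * Real.exp x = 1 := by rw [← Real.exp_add]; simp
    nlinarith [sq_nonneg (Real.exp (-x))]
  calc (1 / Real.cosh x) ^ r ≤ (2 * Real.exp (-x)) ^ r :=
        Real.rpow_le_rpow (sech_pos x).le h hr.le
    _ = 2 ^ r * Real.exp (-r * x) := by
        rw [Real.mul_rpow (by norm_num) (Real.exp_pos _).le, ← Real.exp_mul]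
        ring_nf

lemma integrableOn_sech_rpow {r : ℝ} (hr : 0 < r) :
    IntegrableOn (fun x => (1 / Real.cosh x) ^ r) (Ioi 0) := by
  refine integrable_of_isBigO_exp_neg hr (continuous_sech_rpow r).continuousOn ?_
  refine Asymptotics.IsBigO.of_bound (2 ^ r) (Eventually.of_forall fun x => ?_)
  rw [Real.norm_of_nonneg (Real.rpow_nonneg (sech_pos x).le r),
    Real.norm_of_nonneg (Real.exp_pos _).le]
  exact sech_rpow_le hr x

lemma tendsto_sech_rpow {r : ℝ} (hr : 0 < r) :
    Tendsto (fun x => (1 / Real.cosh x) ^ r) atTop (𝓝 0) := by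
  refine squeeze_zero (fun x => Real.rpow_nonneg (sech_pos x).le r) (sech_rpow_le hr) ?_
  have : Tendsto (fun x : ℝ => Real.exp (-r * x)) atTop (𝓝 0) := by
    refine Real.tendsto_exp_atBot.comp ?_
    exact tendsto_id.const_mul_atTop_of_neg (by linarith)
  simpa using this.const_mul (2 ^ r)

lemma sechInt_pos {r : ℝ} (hr : 0 < r) : 0 < sechInt r := by
  rw [sechInt, setIntegral_pos_iff_support_of_nonneg_ae
    (ae_of_all _ fun x => Real.rpow_nonneg (sech_pos x).le r) (integrableOn_sech_rpow hr)]
  have : Function.support (fun x => (1 / Real.cosh x) ^ r) = univ := by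
    ext x; simpa using (Real.rpow_pos_of_pos (sech_pos x) r).ne'
  rw [this]
  simp

lemma integral_sech_rpow (r : ℝ) : ∫ x, (1 / Real.cosh x) ^ r = 2 * sechInt r := by
  rw [sechInt, ← integral_comp_abs]
  simp [Real.cosh_abs]

lemma sech_rpow_add_two (r x : ℝ) :
    (1 / Real.cosh x) ^ (r + 2) = (1 / Real.cosh x) ^ r * (1 / Real.cosh x) ^ 2 := by
  rw [Real.rpow_add (sech_pos x), Real.rpow_two]

/-- Integrate the derivative of sech^r tanh, which vanishes at 0 and at infinity. Through this
recursion every integral below reduces to a single one. -/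
lemma sechInt_add_two {r : ℝ} (hr : 0 < r) : (r + 1) * sechInt (r + 2) = r * sechInt r := by
  have hd : ∀ x : ℝ, HasDerivAt (fun y => (1 / Real.cosh y) ^ r * Real.tanh y)
      ((r + 1) * (1 / Real.cosh x) ^ (r + 2) - r * (1 / Real.cosh x) ^ r) x := fun x => by
    refine ((hasDerivAt_sech_rpow r x).mul (hasDerivAt_tanh' x)).congr_deriv ?_
    rw [sech_rpow_add_two]
    linear_combination (-r * (1 / Real.cosh x) ^ r) * tanh_sq_eq x
  have i1 := (integrableOn_sech_rpow (r := r + 2) (by linarith)).const_mul (r + 1)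
  have i2 := (integrableOn_sech_rpow hr).const_mul r
  have hlim : Tendsto (fun y => (1 / Real.cosh y) ^ r * Real.tanh y) atTop (𝓝 0) := by
    refine squeeze_zero_norm (fun x => ?_) (tendsto_sech_rpow hr)
    rw [norm_mul, Real.norm_of_nonneg (Real.rpow_nonneg (sech_pos x).le r)]
    have : ‖Real.tanh x‖ ≤ 1 := by
      rw [Real.norm_eq_abs, abs_le_one_iff_mul_self_le_one]
      nlinarith [Real.tanh_sq_lt_one x]
    exact mul_le_of_le_one_right (Real.rpow_nonneg (sech_pos x).le r) this
  have := integral_Ioi_of_hasDerivAt_of_tendsto' (fun x _ => hd x) (i1.sub i2) hlim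
  rw [integral_sub i1 i2, integral_const_mul, integral_const_mul] at this
  simp only [Real.tanh_zero, mul_zero, sub_zero] at this
  simp only [sechInt]
  linarith

/-- Integrals of `sech ^ r tanh ^ 2`. -/
lemma integral_sech_rpow_mul_tanh_sq {r : ℝ} (hr : 0 < r) :
    IntegrableOn (fun x => (1 / Real.cosh x) ^ r * Real.tanh x ^ 2) (Ioi 0) ∧
    ∫ x in Ioi (0 : ℝ), (1 / Real.cosh x) ^ r * Real.tanh x ^ 2 = sechInt r / (r + 1) := by
  have e : (fun x => (1 / Real.cosh x) ^ r * Real.tanh x ^ 2)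
      = fun x => (1 / Real.cosh x) ^ r - (1 / Real.cosh x) ^ (r + 2) := by
    ext x; rw [tanh_sq_eq, sech_rpow_add_two]; ring
  have i1 := integrableOn_sech_rpow hr
  have i2 := integrableOn_sech_rpow (r := r + 2) (by linarith)
  rw [e]
  refine ⟨i1.sub i2, ?_⟩
  rw [integral_sub i1 i2]
  have := sechInt_add_two hr
  change sechInt r - sechInt (r + 2) = _
  field_simp
  linarith

/-! ### The energy of the soliton -/

/-- The least energy at mass `m` on the real line. -/
noncomputable def lineLevel (p m : ℝ) : ℝ :=
  -((6 - p) / (2 * (p + 2)) * m * (solitonK p * m) ^ (2 * (p - 2) / (6 - p)))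

lemma solitonK_eq (p : ℝ) :
    solitonK p = (p - 2) / 2 * (2 / p) ^ (2 / (p - 2)) / (2 * sechInt (4 / (p - 2))) := by
  rw [solitonK, integral_sech_rpow]

lemma solitonK_pos {p : ℝ} (hp : 2 < p) : 0 < solitonK p := by
  rw [solitonK_eq]
  have h : 0 < p - 2 := by linarith
  have h1 : 0 < sechInt (4 / (p - 2)) := sechInt_pos (by positivity)
  have h2 : 0 < p := by linarith
  positivity

lemma integral_even_comp_mul {f : ℝ → ℝ} (hf : ∀ x, f (-x) = f x) {b : ℝ} (hb : 0 < b) :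
    ∫ x, f (b * x) = 2 / b * ∫ x in Ioi (0 : ℝ), f x := by
  have h : ∀ x, f |x| = f x := fun x => by
    rcases abs_choice x with h | h <;> rw [h]
    exact hf x
  rw [Measure.integral_comp_mul_left, abs_of_pos (inv_pos.2 hb), smul_eq_mul]
  have := integral_comp_abs (f := f)
  simp only [h] at this
  rw [this]
  ring

/-- The energy of the profile `A sech ^ q (b x)`. -/
lemma energy_sech_profile {p A b q : ℝ} (hA : 0 < A) (hb : 0 < b) (hq : 0 < q)
    (hqp : q * p = 2 * q + 2) :
    (1 / 2) * (∫ x : ℝ, |deriv (fun x => A * (1 / Real.cosh (b * x)) ^ q) x| ^ 2) -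
      (1 / p) * (∫ x : ℝ, |A * (1 / Real.cosh (b * x)) ^ q| ^ p) =
    sechInt (2 * q) / (2 * q + 1) * (A ^ 2 * q ^ 2 * b - 4 * q / p * (A ^ p / b)) := by
  have h1 : ∀ x, |deriv (fun x => A * (1 / Real.cosh (b * x)) ^ q) x| ^ 2
      = A ^ 2 * q ^ 2 * b ^ 2 * ((1 / Real.cosh (b * x)) ^ (2 * q) * Real.tanh (b * x) ^ 2) := by
    intro x
    have hd : HasDerivAt (fun x => A * (1 / Real.cosh (b * x)) ^ q)
        (A * (-q * (1 / Real.cosh (b * x)) ^ q * Real.tanh (b * x) * b)) x := by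
      have := (hasDerivAt_sech_rpow q (b * x)).comp x
        (by simpa using (hasDerivAt_id x).const_mul b)
      exact this.const_mul A
    rw [hd.deriv, sq_abs, mul_comm 2 q, Real.rpow_mul (sech_pos _).le, Real.rpow_two]
    ring
  have h2 : ∀ x, |A * (1 / Real.cosh (b * x)) ^ q| ^ p
      = A ^ p * (1 / Real.cosh (b * x)) ^ (2 * q + 2) := by
    intro x
    have h0 := Real.rpow_nonneg (sech_pos (b * x)).le q
    rw [abs_of_nonneg (by positivity), Real.mul_rpow hA.le h0, ← Real.rpow_mul (sech_pos _).le, hqp]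
  simp only [h1, h2, integral_const_mul]
  rw [integral_even_comp_mul (f := fun x => (1 / Real.cosh x) ^ (2 * q) * Real.tanh x ^ 2)
      (by simp) hb, (integral_sech_rpow_mul_tanh_sq (by positivity)).2,
    integral_even_comp_mul (f := fun x => (1 / Real.cosh x) ^ (2 * q + 2)) (by simp) hb]
  change _ - 1 / p * (A ^ p * (2 / b * sechInt (2 * q + 2))) = _
  -- The relation `q * p = 2 * q + 2` makes the potential term the next integral in the recursion,
  -- so both terms are multiples of the same one.
  have h3 : sechInt (2 * q + 2) = 2 * q / (2 * q + 1) * sechInt (2 * q) := by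
    have := sechInt_add_two (r := 2 * q) (by positivity)
    rw [div_mul_eq_mul_div, eq_div_iff (by positivity)]
    linarith
  rw [h3]
  field_simp
  ring

/-- In terms of s = √ω the soliton is A sech^q(s x / q) with q = 2/(p-2). Its energy follows from
the equation linking A to s and from the mass normalization built into `solitonK`. -/
lemma solitonEnergy_eq {p : ℝ} (hp₂ : 2 < p) (hp₆ : p < 6) {μ : ℝ} (hμ : 0 < μ) :
    solitonEnergy p μ = lineLevel p μ := by
  have hK := solitonK_pos hp₂
  set K := solitonK p with hKdef
  have a : 0 < p - 2 := by linarith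
  have a' : 0 < 6 - p := by linarith
  have p0 : 0 < p := by linarith
  set s := (K * μ) ^ ((p - 2) / (6 - p)) with hs
  have s0 : 0 < s := by positivity
  set q := 2 / (p - 2) with hq
  have q0 : 0 < q := by positivity
  have hb : solitonFreq p * μ ^ ((p - 2) / (6 - p)) = s / q := by
    rw [solitonFreq, hs, Real.mul_rpow hK.le hμ.le, hq]; field_simp; rfl
  have hA : solitonAmp p * μ ^ (2 / (6 - p)) = (p / 2) ^ (1 / (p - 2)) * s ^ q := by
    rw [solitonAmp, hs, ← Real.rpow_mul (by positivity), Real.mul_rpow hK.le hμ.le, hq]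
    have : (p - 2) / (6 - p) * (2 / (p - 2)) = 2 / (6 - p) := by field_simp
    rw [this]
    ring
  set A := (p / 2) ^ (1 / (p - 2)) * s ^ q with hAdef
  have A0 : 0 < A := by positivity
  have hAp : A ^ p = A ^ 2 * (p / 2 * s ^ 2) := by
    have h1 : A ^ (p - 2) = p / 2 * s ^ 2 := by
      rw [hAdef, Real.mul_rpow (by positivity) (by positivity), ← Real.rpow_mul (by positivity),
        ← Real.rpow_mul s0.le, hq]
      have e1 : 1 / (p - 2) * (p - 2) = 1 := by field_simp
      have e2 : 2 / (p - 2) * (p - 2) = 2 := by field_simp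
      rw [e1, e2, Real.rpow_one, Real.rpow_two]
    rw [← h1, ← Real.rpow_two, ← Real.rpow_add A0]
    ring_nf
  -- This says that the profile has mass `μ`.
  have hmass : A ^ 2 * (sechInt (2 * q) * 2 * q) = μ * s := by
    have hA2 : A ^ 2 = (p / 2) ^ q * s ^ (2 * q) := by
      rw [hAdef, mul_pow, ← Real.rpow_natCast, ← Real.rpow_natCast (s ^ q),
        ← Real.rpow_mul (by positivity), ← Real.rpow_mul s0.le, hq]
      congr 2 <;> push_cast <;> ring
    have e : s ^ (2 * q) = K * μ * s := by
      have : s ^ (2 * q - 1) = K * μ := by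
        rw [hs, ← Real.rpow_mul (by positivity), hq]
        have : (p - 2) / (6 - p) * (2 * (2 / (p - 2)) - 1) = 1 := by field_simp; ring
        rw [this, Real.rpow_one]
      rw [← this, ← Real.rpow_add_one s0.ne']
      ring_nf
    have hKe := solitonK_eq p
    rw [← hKdef, ← hq, show 4 / (p - 2) = 2 * q by rw [hq]; ring] at hKe
    have hJ : 0 < sechInt (2 * q) := sechInt_pos (by positivity)
    have e2 : (2 / p) ^ q * (p / 2) ^ q = 1 := by
      rw [← Real.mul_rpow (by positivity) (by positivity)]
      have : 2 / p * (p / 2) = 1 := by field_simp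
      rw [this, Real.one_rpow]
    have e3 : (p - 2) / 2 * q = 1 := by rw [hq]; field_simp
    have e4 : K * (2 * sechInt (2 * q)) = (p - 2) / 2 * (2 / p) ^ q := by
      rw [hKe]; field_simp
    rw [hA2, e]
    calc (p / 2) ^ q * (K * μ * s) * (sechInt (2 * q) * 2 * q)
        = (K * (2 * sechInt (2 * q))) * ((p / 2) ^ q * q) * (μ * s) := by ring
      _ = ((2 / p) ^ q * (p / 2) ^ q) * ((p - 2) / 2 * q) * (μ * s) := by rw [e4]; ring
      _ = μ * s := by rw [e2, e3]; ring
  have hfun : soliton p μ = fun x => A * (1 / Real.cosh (s / q * x)) ^ q := by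
    ext x; rw [soliton, hb, hA]
  have hs2 : (K * μ) ^ (2 * (p - 2) / (6 - p)) = s ^ 2 := by
    rw [hs, ← Real.rpow_natCast, ← Real.rpow_mul (by positivity)]
    congr 1; push_cast; ring
  rw [solitonEnergy, hfun, energy_sech_profile A0 (by positivity) q0 (by rw [hq]; field_simp; ring),
    hAp, lineLevel, ← hKdef, hs2]
  have h2q : 2 * q + 1 = (p + 2) / (p - 2) := by rw [hq]; field_simp; ring
  have key : sechInt (2 * q) / (2 * q + 1) *
      (A ^ 2 * q ^ 2 * (s / q) - 4 * q / p * (A ^ 2 * (p / 2 * s ^ 2) / (s / q)))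
      = (A ^ 2 * (sechInt (2 * q) * 2 * q)) * s * (1 / 2 - q) / (2 * q + 1) := by
    field_simp
    ring
  rw [key, hmass, h2q, hq]
  field_simp
  ring

/-! ### The action of a profile of given height -/

/-- The slope `|φ'|` of the soliton of height `M` at the point where it takes the value `t`. -/
noncomputable def solitonSlope (p M t : ℝ) : ℝ :=
  √(2 / p * M ^ (p - 2) * t ^ 2 - 2 / p * t ^ p)

/-- The primitive of `solitonSlope` vanishing at `0`. -/
noncomputable def solitonAction (p M s : ℝ) : ℝ := ∫ t in (0 : ℝ)..s, solitonSlope p M t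

lemma continuous_solitonSlope {p : ℝ} (hp : 0 ≤ p) (M : ℝ) : Continuous (solitonSlope p M) := by
  unfold solitonSlope
  have := Real.continuous_rpow_const hp
  fun_prop

lemma solitonSlope_nonneg (p M t : ℝ) : 0 ≤ solitonSlope p M t := Real.sqrt_nonneg _

lemma solitonSlope_sq {p M t : ℝ} (hp : 2 < p) (ht : 0 ≤ t) (htM : t ≤ M) :
    solitonSlope p M t ^ 2 = 2 / p * M ^ (p - 2) * t ^ 2 - 2 / p * t ^ p := by
  rw [solitonSlope, Real.sq_sqrt]
  have h1 : t ^ p = t ^ (p - 2) * t ^ 2 := by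
    rw [← Real.rpow_two, ← Real.rpow_add_of_nonneg ht (by linarith) (by norm_num)]
    ring_nf
  have h2 : t ^ (p - 2) ≤ M ^ (p - 2) := Real.rpow_le_rpow ht htM (by linarith)
  have h3 : 0 ≤ 2 / p := by have : 0 < p := by linarith
                            positivity
  have : 2 / p * M ^ (p - 2) * t ^ 2 - 2 / p * t ^ p
      = 2 / p * (t ^ 2 * (M ^ (p - 2) - t ^ (p - 2))) := by rw [h1]; ring
  rw [this]
  exact mul_nonneg h3 (mul_nonneg (sq_nonneg t) (by linarith))

lemma hasDerivAt_solitonAction {p : ℝ} (hp : 0 ≤ p) (M s : ℝ) :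
    HasDerivAt (solitonAction p M) (solitonSlope p M s) s :=
  (continuous_solitonSlope hp M).integral_hasStrictDerivAt 0 s |>.hasDerivAt

@[simp] lemma solitonAction_zero (p M : ℝ) : solitonAction p M 0 = 0 := by
  simp [solitonAction]

/-- Dropping the negative term under the root bounds the slope by a linear function. The quadratic
bound makes the boundary terms at distance R negligible. -/
lemma solitonAction_le {p M s : ℝ} (hp : 2 < p) (hs : 0 ≤ s) :
    solitonAction p M s ≤ √(2 / p * M ^ (p - 2)) * s ^ 2 / 2 := by
  have p0 : 0 < p := by linarith
  have h : solitonAction p M s ≤ ∫ t in (0 : ℝ)..s, √(2 / p * M ^ (p - 2)) * t := by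
    refine intervalIntegral.integral_mono_on hs
      ((continuous_solitonSlope p0.le M).intervalIntegrable _ _)
      ((by fun_prop : Continuous fun t : ℝ => √(2 / p * M ^ (p - 2)) * t).intervalIntegrable _ _)
      fun t ht => ?_
    calc solitonSlope p M t ≤ √(2 / p * M ^ (p - 2) * t ^ 2) := by
          refine Real.sqrt_le_sqrt ?_
          have := Real.rpow_nonneg ht.1 p
          have : 0 ≤ 2 / p * t ^ p := by positivity
          linarith
      _ = _ := by rw [Real.sqrt_mul' _ (sq_nonneg t), Real.sqrt_sq ht.1]
  refine h.trans (le_of_eq ?_)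
  rw [intervalIntegral.integral_const_mul, integral_id]
  ring

/-- The action of the full height, computed along the soliton. -/
lemma solitonAction_self {p M : ℝ} (hp : 2 < p) (hM : 0 < M) :
    solitonAction p M M = √(2 / p * M ^ (p - 2)) * M ^ 2 * (2 / (p - 2)) *
      (sechInt (4 / (p - 2)) / (4 / (p - 2) + 1)) := by
  have p0 : 0 < p := by linarith
  have a : 0 < p - 2 := by linarith
  set σ := √(2 / p * M ^ (p - 2)) with hσ
  have hσ0 : 0 < σ := by positivity
  have hσ2 : σ ^ 2 = 2 / p * M ^ (p - 2) := Real.sq_sqrt (by positivity)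
  set q := 2 / (p - 2) with hq
  have q0 : 0 < q := by positivity
  have h2q : 4 / (p - 2) = 2 * q := by rw [hq]; ring
  have hqp : q * (p - 2) = 2 := by rw [hq]; field_simp
  rw [h2q]
  set b := σ / q with hb
  have b0 : 0 < b := by positivity
  -- The decreasing half of the soliton of height M solves φ' = -slope(φ). The action along it
  -- therefore has derivative -slope(φ)², an explicit power of sech times tanh².
  let φ : ℝ → ℝ := fun x => M * (1 / Real.cosh (b * x)) ^ q
  have hφpos : ∀ x, 0 < φ x := fun x => mul_pos hM (Real.rpow_pos_of_pos (sech_pos _) _)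
  have hφd : ∀ x, HasDerivAt φ (-(σ * φ x * Real.tanh (b * x))) x := fun x => by
    have h1 := (hasDerivAt_sech_rpow q (b * x)).comp x
      (by simpa using (hasDerivAt_id x).const_mul b)
    refine (h1.const_mul M).congr_deriv ?_
    simp only [φ, hb]
    field_simp
  have hslope : ∀ x ∈ Ici (0 : ℝ), solitonSlope p M (φ x) = σ * φ x * Real.tanh (b * x) := by
    intro x hx
    have ht : 0 ≤ Real.tanh (b * x) := by
      rw [Real.tanh_eq_sinh_div_cosh]
      exact div_nonneg (Real.sinh_nonneg_iff.2 (mul_nonneg b0.le hx)) (Real.cosh_pos _).le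
    have h1 : φ x ^ p = M ^ (p - 2) * (1 / Real.cosh (b * x)) ^ 2 * φ x ^ 2 := by
      have e : φ x ^ (p - 2) = M ^ (p - 2) * (1 / Real.cosh (b * x)) ^ 2 := by
        simp only [φ]
        rw [Real.mul_rpow hM.le (Real.rpow_nonneg (sech_pos _).le _),
          ← Real.rpow_mul (sech_pos _).le, hqp, Real.rpow_two]
      rw [← e, ← Real.rpow_two, ← Real.rpow_add (hφpos x)]
      ring_nf
    rw [solitonSlope, h1]
    have h2 : 2 / p * M ^ (p - 2) * φ x ^ 2
          - 2 / p * (M ^ (p - 2) * (1 / Real.cosh (b * x)) ^ 2 * φ x ^ 2)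
        = (σ * φ x * Real.tanh (b * x)) ^ 2 := by
      rw [mul_pow (σ * φ x), mul_pow σ, tanh_sq_eq, hσ2]; ring
    rw [h2, Real.sqrt_sq (mul_nonneg (mul_nonneg hσ0.le (hφpos x).le) ht)]
  have hd : ∀ x ∈ Ici (0 : ℝ), HasDerivAt (fun x => solitonAction p M (φ x))
      (-(σ ^ 2 * M ^ 2 * ((1 / Real.cosh (b * x)) ^ (2 * q) * Real.tanh (b * x) ^ 2))) x := by
    intro x hx
    refine ((hasDerivAt_solitonAction p0.le M (φ x)).comp x (hφd x)).congr_deriv ?_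
    rw [hslope x hx, mul_comm 2 q, Real.rpow_mul (sech_pos _).le, Real.rpow_two]
    simp only [φ]
    ring
  obtain ⟨hint, hval⟩ := integral_sech_rpow_mul_tanh_sq (r := 2 * q) (by positivity)
  have hint' := ((integrableOn_Ioi_comp_mul_left_iff
    (fun x => (1 / Real.cosh x) ^ (2 * q) * Real.tanh x ^ 2) 0 b0).2 (by simpa using hint))
  have hlim : Tendsto (fun x => solitonAction p M (φ x)) atTop (𝓝 0) := by
    have h1 : Tendsto φ atTop (𝓝 0) := by
      have := ((tendsto_sech_rpow q0).comp (tendsto_id.const_mul_atTop b0)).const_mul M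
      simpa [φ, Function.comp_def] using this
    have h2 := (hasDerivAt_solitonAction p0.le M 0).continuousAt.tendsto.comp h1
    simpa [Function.comp_def] using h2
  have key := integral_Ioi_of_hasDerivAt_of_tendsto' hd (hint'.const_mul (σ ^ 2 * M ^ 2)).neg hlim
  have hφ0 : φ 0 = M := by simp [φ]
  rw [integral_neg, integral_const_mul, integral_comp_mul_left_Ioi
    (fun x => (1 / Real.cosh x) ^ (2 * q) * Real.tanh x ^ 2) 0 b0, mul_zero, hval, hφ0,
    smul_eq_mul] at key
  have : solitonAction p M M = σ ^ 2 * M ^ 2 * (b⁻¹ * (sechInt (2 * q) / (2 * q + 1))) := by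
    linarith
  rw [this, hb]
  field_simp

/-- The energy at mass `m` of a profile of height `M` is at least the least energy on the line. -/
lemma lineLevel_le {p M m : ℝ} (hp₂ : 2 < p) (hp₆ : p < 6) (hM : 0 ≤ M) (hm : 0 ≤ m) :
    lineLevel p m ≤ 2 * solitonAction p M M - 1 / p * M ^ (p - 2) * m := by
  have p0 : 0 < p := by linarith
  have a : 0 < p - 2 := by linarith
  have a' : 0 < 6 - p := by linarith
  have hK := solitonK_pos hp₂
  rcases hM.eq_or_lt with rfl | hM
  · rw [solitonAction_zero, Real.zero_rpow a.ne', lineLevel]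
    have : 0 ≤ (6 - p) / (2 * (p + 2)) * m * (solitonK p * m) ^ (2 * (p - 2) / (6 - p)) := by
      positivity
    linarith
  rw [solitonAction_self hp₂ hM]
  set σ := √(2 / p * M ^ (p - 2)) with hσ
  have hσ0 : 0 < σ := by positivity
  have hσ2 : σ ^ 2 = 2 / p * M ^ (p - 2) := Real.sq_sqrt (by positivity)
  set q := 2 / (p - 2) with hq
  have q0 : 0 < q := by positivity
  have q1 : 0 < 2 * q - 1 := by
    have : 2 * q - 1 = (6 - p) / (p - 2) := by rw [hq]; field_simp; ring
    rw [this]; positivity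
  have h2q : 4 / (p - 2) = 2 * q := by rw [hq]; ring
  have hqp : q * (p - 2) = 2 := by rw [hq]; field_simp
  set K := solitonK p with hKdef
  set s := (K * m) ^ ((p - 2) / (6 - p)) with hs
  have hs0 : 0 ≤ s := by positivity
  have hsK : s ^ (2 * q - 1) = K * m := by
    rw [hs, ← Real.rpow_mul (by positivity), hq]
    have : (p - 2) / (6 - p) * (2 * (2 / (p - 2)) - 1) = 1 := by field_simp; ring
    rw [this, Real.rpow_one]
  have hs2 : (K * m) ^ (2 * (p - 2) / (6 - p)) = s ^ 2 := by
    rw [hs, ← Real.rpow_natCast, ← Real.rpow_mul (by positivity)]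
    congr 1; push_cast; ring
  -- The definition of K cleared of denominators; it turns the action into a pure power of σ.
  have hKe : K * (2 * sechInt (2 * q)) * q = (2 / p) ^ q := by
    have hJ : 0 < sechInt (2 * q) := sechInt_pos (by positivity)
    have h1 := solitonK_eq p
    rw [← hKdef, ← hq, h2q] at h1
    have : (p - 2) / 2 * q = 1 := by linarith
    rw [h1]
    field_simp
    linear_combination hqp
  have hMσ : σ ^ (2 * q) = (2 / p) ^ q * M ^ 2 := by
    rw [Real.rpow_mul hσ0.le, Real.rpow_two, hσ2, Real.mul_rpow (by positivity) (by positivity),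
      ← Real.rpow_mul hM.le, mul_comm (p - 2), hqp, Real.rpow_two]
  have hact : K * (2 * (σ * M ^ 2 * q * (sechInt (2 * q) / (2 * q + 1))))
      = σ ^ (2 * q + 1) / (2 * q + 1) := by
    rw [Real.rpow_add_one hσ0.ne', hMσ, ← hKe]; ring
  -- Equality holds at σ = s, that is, when M is the height of the soliton of mass m. This is why
  -- the bound is sharp.
  have young : σ ^ 2 * s ^ (2 * q - 1) ≤
      2 / (2 * q + 1) * σ ^ (2 * q + 1) + (2 * q - 1) / (2 * q + 1) * s ^ (2 * q + 1) := by
    have := Real.geom_mean_le_arith_mean2_weighted (w₁ := 2 / (2 * q + 1))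
      (w₂ := (2 * q - 1) / (2 * q + 1)) (p₁ := σ ^ (2 * q + 1)) (p₂ := s ^ (2 * q + 1))
      (by positivity) (by positivity) (by positivity) (by positivity) (by field_simp; ring)
    rw [← Real.rpow_mul hσ0.le, ← Real.rpow_mul hs0] at this
    have e1 : (2 * q + 1) * (2 / (2 * q + 1)) = 2 := by field_simp
    have e2 : (2 * q + 1) * ((2 * q - 1) / (2 * q + 1)) = 2 * q - 1 := by field_simp
    rwa [e1, e2, Real.rpow_two] at this
  have hs3 : s ^ (2 * q + 1) = K * m * s ^ 2 := by
    rw [← hsK, ← Real.rpow_two, ← Real.rpow_add_of_nonneg hs0 q1.le (by norm_num)]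
    ring_nf
  rw [hsK, hs3] at young
  have hcoef : (6 - p) / (2 * (p + 2)) = (2 * q - 1) / (2 * q + 1) / 2 := by
    rw [hq]; field_simp; ring
  rw [lineLevel, ← hKdef, hs2, hcoef, h2q, ← mul_le_mul_iff_right₀ hK]
  have e4 : K * (2 * (σ * M ^ 2 * q * (sechInt (2 * q) / (2 * q + 1))) - 1 / p * M ^ (p - 2) * m)
      = σ ^ (2 * q + 1) / (2 * q + 1) - σ ^ 2 * (K * m) / 2 := by
    rw [mul_sub, hact, hσ2]; ring
  rw [e4]
  have e5 : 2 / (2 * q + 1) * σ ^ (2 * q + 1) = 2 * (σ ^ (2 * q + 1) / (2 * q + 1)) := by ring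
  have e6 : K * -((2 * q - 1) / (2 * q + 1) / 2 * m * s ^ 2)
      = -((2 * q - 1) / (2 * q + 1) * (K * m * s ^ 2) / 2) := by ring
  rw [e5] at young
  rw [e6]
  linarith

lemma continuous_lineLevel {p : ℝ} (hp₂ : 2 < p) (hp₆ : p < 6) : Continuous (lineLevel p) := by
  have : 0 ≤ 2 * (p - 2) / (6 - p) := div_nonneg (by linarith) (by linarith)
  have := Real.continuous_rpow_const this
  unfold lineLevel
  fun_prop

lemma lineLevel_zero (p : ℝ) : lineLevel p 0 = 0 := by simp [lineLevel]

/-- The level `lineLevel p` is superlinear. -/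
lemma mul_lineLevel_le {p m μ : ℝ} (hp₂ : 2 < p) (hp₆ : p < 6) (hm : 0 ≤ m) (hmμ : m ≤ μ)
    (hμ : 0 < μ) : m / μ * lineLevel p μ ≤ lineLevel p m := by
  have a' : 0 < 6 - p := by linarith
  have hK := solitonK_pos hp₂
  have h : (solitonK p * m) ^ (2 * (p - 2) / (6 - p)) ≤
      (solitonK p * μ) ^ (2 * (p - 2) / (6 - p)) :=
    Real.rpow_le_rpow (by positivity) (by gcongr) (div_nonneg (by linarith) a'.le)
  have h2 : 0 ≤ (6 - p) / (2 * (p + 2)) * m := by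
    have : 0 < p + 2 := by linarith
    positivity
  have h3 := mul_le_mul_of_nonneg_left h h2
  have e : m / μ * lineLevel p μ = -((6 - p) / (2 * (p + 2)) * m *
      (solitonK p * μ) ^ (2 * (p - 2) / (6 - p))) := by
    rw [lineLevel]; field_simp
  rw [e, lineLevel]
  linarith

/-! ### Weak derivatives and the fundamental theorem of calculus -/

lemma deriv_smoothTransition_of_notMem {t : ℝ} (ht : t ∉ Icc (0 : ℝ) 1) :
    deriv Real.smoothTransition t = 0 := by
  rw [mem_Icc, not_and_or, not_le, not_le] at ht
  rcases ht with ht | ht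
  · have : Real.smoothTransition =ᶠ[𝓝 t] fun _ => 0 := by
      filter_upwards [Iio_mem_nhds ht] with y hy using Real.smoothTransition.zero_of_nonpos hy.le
    simpa using this.deriv_eq
  · have : Real.smoothTransition =ᶠ[𝓝 t] fun _ => 1 := by
      filter_upwards [Ioi_mem_nhds ht] with y hy using Real.smoothTransition.one_of_one_le hy.le
    simpa using this.deriv_eq

lemma continuous_deriv_smoothTransition : Continuous (deriv Real.smoothTransition) :=
  (Real.smoothTransition.contDiff (n := 1)).continuous_deriv le_rfl

lemma integral_deriv_smoothTransition :
    ∫ t in (0 : ℝ)..1, deriv Real.smoothTransition t = 1 := by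
  rw [intervalIntegral.integral_deriv_eq_sub
    (fun t _ => (Real.smoothTransition.contDiff (n := 1)).differentiable (by norm_num) t)
    (continuous_deriv_smoothTransition.intervalIntegrable _ _)]
  simp

/-- The rescaled derivatives of the smooth transition are an approximate identity. -/
lemma tendsto_integral_deriv_smoothTransition {f : ℝ → ℂ} {a b c : ℝ}
    (hf : ContinuousOn f (Icc a b)) (hc : c ∈ Ico a b) :
    Tendsto (fun ε => ∫ x in Icc a b, (ε⁻¹ * deriv Real.smoothTransition ((x - c) / ε)) • f x)
      (𝓝[>] 0) (𝓝 (f c)) := by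
  have hr : 0 < b - c := by linarith [hc.2]
  have hmem : ∀ᶠ ε in 𝓝[>] (0 : ℝ), ε ∈ Ioo 0 (b - c) := Ioo_mem_nhdsGT hr
  have hsub : ∀ ε ∈ Ioo 0 (b - c), ∀ t ∈ Icc (0 : ℝ) 1, ε * t + c ∈ Icc a b := by
    intro ε hε t ht
    constructor
    · nlinarith [hc.1, hε.1, ht.1]
    · nlinarith [hε.2, ht.2, hε.1]
  have heq : ∀ᶠ ε in 𝓝[>] (0 : ℝ),
      ∫ t in (0 : ℝ)..1, deriv Real.smoothTransition t • f (ε * t + c) =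
      ∫ x in Icc a b, (ε⁻¹ * deriv Real.smoothTransition ((x - c) / ε)) • f x := by
    filter_upwards [hmem] with ε hε
    have h1 : ∫ x in Icc a b, (ε⁻¹ * deriv Real.smoothTransition ((x - c) / ε)) • f x =
        -- The transition takes place entirely to the right of c, so c may be the left endpoint of
        -- the interval.
        ∫ x in Icc c (ε + c), (ε⁻¹ * deriv Real.smoothTransition ((x - c) / ε)) • f x := by
      refine setIntegral_eq_of_subset_of_forall_sdiff_eq_zero measurableSet_Icc
        (Icc_subset_Icc hc.1 (by linarith [hε.2])) fun x hx => ?_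
      rw [deriv_smoothTransition_of_notMem, mul_zero, zero_smul]
      intro h
      refine hx.2 ⟨?_, ?_⟩
      · have := (le_div_iff₀ hε.1).1 h.1; linarith
      · have := (div_le_iff₀ hε.1).1 h.2; linarith
    rw [h1, integral_Icc_eq_integral_Ioc,
      ← intervalIntegral.integral_of_le (by linarith [hε.1] : c ≤ ε + c)]
    have h2 := intervalIntegral.integral_comp_mul_add (a := 0) (b := 1)
      (fun x => (ε⁻¹ * deriv Real.smoothTransition ((x - c) / ε)) • f x) hε.1.ne' c
    simp only [add_sub_cancel_right, mul_div_cancel_left₀ _ hε.1.ne', mul_zero, zero_add,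
      mul_one] at h2
    have h3 : ∫ t in (0 : ℝ)..1, deriv Real.smoothTransition t • f (ε * t + c)
        = ε • ∫ t in (0 : ℝ)..1, (ε⁻¹ * deriv Real.smoothTransition t) • f (ε * t + c) := by
      rw [← intervalIntegral.integral_smul]
      refine intervalIntegral.integral_congr fun t _ => ?_
      rw [smul_smul, mul_inv_cancel_left₀ hε.1.ne']
    rw [h3, h2, smul_inv_smul₀ hε.1.ne']
  refine Tendsto.congr' heq ?_
  have hval : f c = ∫ t in (0 : ℝ)..1, deriv Real.smoothTransition t • f c := by
    rw [intervalIntegral.integral_smul_const, integral_deriv_smoothTransition, one_smul]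
  rw [hval]
  obtain ⟨C, hC⟩ := isCompact_Icc.exists_bound_of_continuousOn hf
  refine intervalIntegral.tendsto_integral_filter_of_dominated_convergence
    (fun t => ‖deriv Real.smoothTransition t‖ * C) ?_ ?_ ?_ ?_
  · filter_upwards [hmem] with ε hε
    refine ContinuousOn.aestronglyMeasurable ?_ measurableSet_uIoc
    refine continuous_deriv_smoothTransition.continuousOn.smul
      (hf.comp (by fun_prop) fun t ht => hsub ε hε t ?_)
    rw [uIoc_of_le zero_le_one] at ht
    exact Ioc_subset_Icc_self ht
  · filter_upwards [hmem] with ε hε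
    refine ae_of_all _ fun t ht => ?_
    rw [uIoc_of_le zero_le_one] at ht
    rw [norm_smul]
    exact mul_le_mul_of_nonneg_left (hC _ (hsub ε hε t (Ioc_subset_Icc_self ht))) (norm_nonneg _)
  · exact (continuous_deriv_smoothTransition.norm.mul continuous_const).intervalIntegrable _ _
  · refine ae_of_all _ fun t ht => ?_
    rw [uIoc_of_le zero_le_one] at ht
    refine tendsto_const_nhds.smul ?_
    have h1 : ContinuousWithinAt f (Icc a b) c := hf c ⟨hc.1, hc.2.le⟩
    refine h1.tendsto.comp (tendsto_nhdsWithin_iff.2 ⟨?_, ?_⟩)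
    · have : Tendsto (fun ε : ℝ => ε * t + c) (𝓝 0) (𝓝 (0 * t + c)) :=
        (by fun_prop : Continuous fun ε : ℝ => ε * t + c).tendsto 0
      simpa using this.mono_left nhdsWithin_le_nhds
    · filter_upwards [hmem] with ε hε using hsub ε hε t (Ioc_subset_Icc_self ht)

/-- Test against a smoothed indicator of [c, d], the difference of two transitions of width ε. Its
derivative tends to a point mass at c minus one at d. The margin r leaves room for the second
transition, which ends at d + ε. -/
lemma HasWeakDerivOn.sub_eq_integral_of_subset_interior {f g : ℝ → ℂ} {I : Set ℝ} {c d r : ℝ}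
    (h : HasWeakDerivOn f g I) (hI : MeasurableSet I) (hcd : c ≤ d) (hr : 0 < r)
    (hsub : Icc c (d + r) ⊆ interior I) (hf : ContinuousOn f (Icc c (d + r)))
    (hg : IntegrableOn g (Icc c (d + r))) : f d - f c = ∫ x in c..d, g x := by
  set S := Real.smoothTransition with hS
  set K := Icc c (d + r) with hK
  have hKI : K ⊆ I := hsub.trans interior_subset
  let η : ℝ → ℝ → ℝ := fun ε x => S ((x - c) / ε) - S ((x - d) / ε)
  have hSd : ∀ ε e x : ℝ, HasDerivAt (fun y => S ((y - e) / ε))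
      (ε⁻¹ * deriv S ((x - e) / ε)) x := by
    intro ε e x
    have h1 : HasDerivAt S (deriv S ((x - e) / ε)) ((x - e) / ε) :=
      ((Real.smoothTransition.contDiff (n := 1)).differentiable (by norm_num) _).hasDerivAt
    have h2 : HasDerivAt (fun y : ℝ => (y - e) / ε) (1 / ε) x :=
      ((hasDerivAt_id x).sub_const e).div_const ε
    refine (h1.comp x h2).congr_deriv ?_
    rw [one_div, mul_comm]
  have hderiv : ∀ ε x : ℝ, deriv (η ε) x =
      ε⁻¹ * deriv S ((x - c) / ε) - ε⁻¹ * deriv S ((x - d) / ε) := fun ε x =>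
    ((hSd ε c x).sub (hSd ε d x)).deriv
  have hηzero : ∀ ε ∈ Ioo 0 r, ∀ x, x ∉ K → η ε x = 0 := by
    intro ε hε x hx
    rw [hK, mem_Icc, not_and_or, not_le, not_le] at hx
    simp only [η, hS]
    rcases hx with hx | hx
    · rw [Real.smoothTransition.zero_of_nonpos (div_nonpos_of_nonpos_of_nonneg (by linarith) hε.1.le),
        Real.smoothTransition.zero_of_nonpos
          (div_nonpos_of_nonpos_of_nonneg (by linarith) hε.1.le), sub_self]
    · rw [Real.smoothTransition.one_of_one_le ((one_le_div hε.1).2 (by linarith [hε.2])),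
        Real.smoothTransition.one_of_one_le ((one_le_div hε.1).2 (by linarith [hε.2])), sub_self]
  have hts : ∀ ε ∈ Ioo 0 r, tsupport (η ε) ⊆ K := fun ε hε =>
    closure_minimal (fun x hx => by_contra fun hxK => hx (hηzero ε hε x hxK)) isClosed_Icc
  have hmem : ∀ᶠ ε in 𝓝[>] (0 : ℝ), ε ∈ Ioo 0 r := Ioo_mem_nhdsGT hr
  have hint : ∀ ε e : ℝ,
      IntegrableOn (fun x => (ε⁻¹ * deriv S ((x - e) / ε)) • f x) K := by
    intro ε e
    refine ContinuousOn.integrableOn_compact isCompact_Icc (ContinuousOn.fun_smul ?_ hf)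
    have := continuous_deriv_smoothTransition
    fun_prop
  have hid : ∀ᶠ ε in 𝓝[>] (0 : ℝ),
      (∫ x in K, (ε⁻¹ * deriv S ((x - c) / ε)) • f x) -
        (∫ x in K, (ε⁻¹ * deriv S ((x - d) / ε)) • f x) = -∫ x in K, η ε x • g x := by
    filter_upwards [hmem] with ε hε
    have hsm : ContDiff ℝ ∞ (η ε) := by
      have := Real.smoothTransition.contDiff (n := (⊤ : ℕ∞))
      simp only [η, hS]
      exact (this.comp (by fun_prop)).sub (this.comp (by fun_prop))
    have hcs : HasCompactSupport (η ε) := isCompact_Icc.of_isClosed_subset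
      (isClosed_tsupport _) (hts ε hε)
    have := h (η ε) hsm hcs ((hts ε hε).trans hsub)
    have e1 : ∫ x in I, deriv (η ε) x • f x = ∫ x in K, deriv (η ε) x • f x := by
      refine setIntegral_eq_of_subset_of_forall_sdiff_eq_zero hI hKI fun x hx => ?_
      have : deriv (η ε) x = 0 := by
        by_contra h0
        exact hx.2 (hts ε hε (support_deriv_subset h0))
      rw [this, zero_smul]
    have e2 : ∫ x in I, η ε x • g x = ∫ x in K, η ε x • g x :=
      setIntegral_eq_of_subset_of_forall_sdiff_eq_zero hI hKI fun x hx => by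
        rw [hηzero ε hε x hx.2, zero_smul]
    rw [e1, e2] at this
    rw [← this, ← integral_sub (hint ε c) (hint ε d)]
    refine integral_congr_ae (ae_of_all _ fun x => ?_)
    simp only [hderiv, sub_smul]
  have hl := (tendsto_integral_deriv_smoothTransition (c := c) hf
    ⟨le_rfl, by linarith⟩).sub
    (tendsto_integral_deriv_smoothTransition (c := d) hf ⟨hcd, by linarith⟩)
  have hr' : Tendsto (fun ε => ∫ x in K, η ε x • g x) (𝓝[>] 0)
      (𝓝 (∫ x in K, (Ioc c d).indicator g x)) := by
    refine tendsto_integral_filter_of_dominated_convergence (fun x => ‖g x‖) ?_ ?_ hg.norm ?_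
    · refine Eventually.of_forall fun ε => AEStronglyMeasurable.fun_smul ?_ hg.aestronglyMeasurable
      have := Real.smoothTransition.continuous
      exact (by simp only [η, hS]; fun_prop : Continuous (η ε)).aestronglyMeasurable
    · refine Eventually.of_forall fun ε => ae_of_all _ fun x => ?_
      rw [norm_smul]
      refine mul_le_of_le_one_left (norm_nonneg _) ?_
      rw [Real.norm_eq_abs, abs_le]
      have h1 := Real.smoothTransition.nonneg ((x - c) / ε)
      have h2 := Real.smoothTransition.le_one ((x - c) / ε)
      have h3 := Real.smoothTransition.nonneg ((x - d) / ε)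
      have h4 := Real.smoothTransition.le_one ((x - d) / ε)
      simp only [η, hS]
      constructor <;> linarith
    · refine ae_of_all _ fun x => ?_
      have step : ∀ e, ∀ᶠ ε in 𝓝[>] (0 : ℝ), S ((x - e) / ε) = if x ≤ e then 0 else 1 := by
        intro e
        split_ifs with hx
        · filter_upwards [self_mem_nhdsWithin] with ε hε
          exact Real.smoothTransition.zero_of_nonpos
            (div_nonpos_of_nonpos_of_nonneg (by linarith) (le_of_lt hε))
        · have : (0 : ℝ) < x - e := by linarith
          filter_upwards [Ioo_mem_nhdsGT this] with ε hε
          exact Real.smoothTransition.one_of_one_le ((one_le_div hε.1).2 hε.2.le)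
      refine tendsto_const_nhds.congr' ?_
      filter_upwards [step c, step d] with ε h1 h2
      simp only [η, h1, h2]
      by_cases hxc : x ≤ c
      · simp [hxc, hxc.trans hcd]
      · by_cases hxd : x ≤ d
        · rw [indicator_of_mem (show x ∈ Ioc c d from ⟨lt_of_not_ge hxc, hxd⟩)]; simp [hxc, hxd]
        · rw [indicator_of_notMem fun h => hxd h.2]; simp [hxc, hxd]
  have := tendsto_nhds_unique (hl.congr' hid) hr'.neg
  rw [setIntegral_indicator measurableSet_Ioc, inter_eq_self_of_subset_right
    (Ioc_subset_Icc_self.trans (Icc_subset_Icc le_rfl (by linarith))),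
    ← intervalIntegral.integral_of_le hcd] at this
  linear_combination -this

/-- A continuous function with a weak derivative is a primitive of it. -/
lemma HasWeakDerivOn.sub_eq_integral {f g : ℝ → ℂ} {I : Set ℝ} {x y : ℝ}
    (h : HasWeakDerivOn f g I) (hI : MeasurableSet I) (hxy : x ≤ y) (hsub : Icc x y ⊆ I)
    (hf : ContinuousOn f (Icc x y)) (hg : IntegrableOn g (Icc x y)) :
    f y - f x = ∫ t in x..y, g t := by
  rcases hxy.eq_or_lt with rfl | hlt
  · simp
  have hr : 0 < (y - x) / 2 := by linarith
  have hgi : IntervalIntegrable g volume x y :=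
    (intervalIntegrable_iff_integrableOn_Icc_of_le hxy).2 hg
  have hprim : ContinuousOn (fun b => ∫ t in x..b, g t) (Icc x y) := by
    have := intervalIntegral.continuousOn_primitive_interval (μ := volume) (f := g) (a := x) (b := y)
      (by rwa [uIcc_of_le hxy])
    rwa [uIcc_of_le hxy] at this
  have hmem : ∀ᶠ δ in 𝓝[>] (0 : ℝ), δ ∈ Ioo 0 ((y - x) / 2) := Ioo_mem_nhdsGT hr
  have hl : Tendsto (fun δ => x + δ) (𝓝[>] 0) (𝓝[Icc x y] x) := by
    refine tendsto_nhdsWithin_iff.2 ⟨?_, ?_⟩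
    · have := (by fun_prop : Continuous fun δ : ℝ => x + δ).tendsto 0
      simpa using this.mono_left nhdsWithin_le_nhds
    · filter_upwards [hmem] with δ hδ using ⟨by linarith [hδ.1], by linarith [hδ.2]⟩
  have hr : Tendsto (fun δ => y - δ) (𝓝[>] 0) (𝓝[Icc x y] y) := by
    refine tendsto_nhdsWithin_iff.2 ⟨?_, ?_⟩
    · have := (by fun_prop : Continuous fun δ : ℝ => y - δ).tendsto 0
      simpa using this.mono_left nhdsWithin_le_nhds
    · filter_upwards [hmem] with δ hδ using ⟨by linarith [hδ.2], by linarith [hδ.1]⟩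
  have hx : x ∈ Icc x y := ⟨le_rfl, hxy⟩
  have hy : y ∈ Icc x y := ⟨hxy, le_rfl⟩
  have t1 := ((hf y hy).tendsto.comp hr).sub ((hf x hx).tendsto.comp hl)
  have t2 := ((hprim y hy).tendsto.comp hr).sub ((hprim x hx).tendsto.comp hl)
  simp only [intervalIntegral.integral_same, sub_zero] at t2
  refine tendsto_nhds_unique t1 (t2.congr' ?_)
  filter_upwards [hmem] with δ hδ
  have hs : Icc (x + δ) (y - δ + δ / 2) ⊆ Icc x y :=
    Icc_subset_Icc (by linarith [hδ.1]) (by linarith [hδ.1])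
  have hsi : Icc (x + δ) (y - δ + δ / 2) ⊆ interior I := by
    refine Subset.trans (fun z hz => ?_) (interior_maximal (Ioo_subset_Icc_self.trans hsub) isOpen_Ioo)
    exact ⟨by linarith [hz.1, hδ.1], by linarith [hz.2, hδ.1]⟩
  -- The endpoints may lie on the boundary of I, so the interval is shrunk and δ tends to 0; r = δ/2
  -- keeps the margin inside.
  have key := h.sub_eq_integral_of_subset_interior hI (c := x + δ) (d := y - δ) (r := δ / 2)
    (by linarith [hδ.2]) (by linarith [hδ.1]) hsi (hf.mono hs) (hg.mono_set hs)
  simp only [Function.comp_apply]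
  rw [key, eq_comm, intervalIntegral.integral_interval_sub_left]
  · exact hgi.mono_set (by rw [uIcc_of_le hxy, uIcc_of_le (by linarith [hδ.2])]
                           exact Icc_subset_Icc le_rfl (by linarith [hδ.1]))
  · exact hgi.mono_set (by rw [uIcc_of_le hxy, uIcc_of_le (by linarith [hδ.1])]
                           exact Icc_subset_Icc le_rfl (by linarith [hδ.2]))

/-! ### Primitives of integrable functions -/

/-- Absolute continuity passes to any function whose increments are dominated. It is used to go from
the primitive of |g| to |f|, and from there to G(|f|). -/
lemma AbsolutelyContinuousOnInterval.of_dist_le {X Y : Type*} [PseudoMetricSpace X]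
    [PseudoMetricSpace Y] {f : ℝ → X} {Φ : ℝ → Y} {a b C : ℝ}
    (hΦ : AbsolutelyContinuousOnInterval Φ a b)
    (h : ∀ x ∈ uIcc a b, ∀ y ∈ uIcc a b, dist (f x) (f y) ≤ C * dist (Φ x) (Φ y)) :
    AbsolutelyContinuousOnInterval f a b := by
  unfold AbsolutelyContinuousOnInterval at hΦ ⊢
  have h2 := hΦ.const_mul C
  rw [mul_zero] at h2
  refine squeeze_zero' (Eventually.of_forall fun E => Finset.sum_nonneg fun _ _ => dist_nonneg)
    ?_ h2
  have : ∀ᶠ E in totalLengthFilter ⊓ 𝓟 (disjWithin a b), E ∈ disjWithin a b :=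
    eventually_inf_principal.2 (by simp)
  filter_upwards [this] with E hE
  rw [Finset.mul_sum]
  exact Finset.sum_le_sum fun i hi => h _ (hE.1 i hi).1 _ (hE.1 i hi).2

/-- The reverse triangle inequality for the difference quotients, in the limit. -/
lemma abs_deriv_norm_le {f : ℝ → ℂ} {f' : ℂ} {x : ℝ} (hf : HasDerivAt f f' x)
    (hN : DifferentiableAt ℝ (fun y => ‖f y‖) x) : |deriv (fun y => ‖f y‖) x| ≤ ‖f'‖ := by
  have h1 := (hasDerivAt_iff_tendsto_slope.1 hN.hasDerivAt).norm
  have h2 := (hasDerivAt_iff_tendsto_slope.1 hf).norm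
  refine le_of_tendsto_of_tendsto' h1 h2 fun y => ?_
  simp only [slope, vsub_eq_sub, norm_smul]
  exact mul_le_mul_of_nonneg_left (abs_norm_sub_norm_le _ _) (norm_nonneg _)

/-- If `G' = F` then the variation of `G (‖f‖)` is at most the integral of `F (‖f‖) ‖f'‖`. -/
lemma abs_comp_norm_sub_le {f g : ℝ → ℂ} {F G : ℝ → ℝ} {a b : ℝ} (hab : a ≤ b)
    (hF : Continuous F) (hF0 : ∀ t, 0 ≤ F t) (hG : ∀ t, HasDerivAt G (F t) t)
    (hf : ContinuousOn f (Icc a b)) (hg : IntegrableOn g (Icc a b))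
    (hfg : ∀ x ∈ Icc a b, ∀ y ∈ Icc a b, x ≤ y → f y - f x = ∫ t in x..y, g t) :
    |G ‖f b‖ - G ‖f a‖| ≤ ∫ x in a..b, F ‖f x‖ * ‖g x‖ := by
  have hgi : IntervalIntegrable g volume a b :=
    (intervalIntegrable_iff_integrableOn_Icc_of_le hab).2 hg
  have hgn := hgi.norm
  have hΦ := hgn.absolutelyContinuousOnInterval_intervalIntegral (c := a) (by simp)
  have hsub : ∀ x ∈ Icc a b, ∀ y ∈ Icc a b, IntervalIntegrable (fun t => ‖g t‖) volume x y :=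
    fun x hx y hy => hgn.mono_set (by
      rw [uIcc_of_le hab]; exact uIcc_subset_Icc hx hy)
  have hdist : ∀ x ∈ Icc a b, ∀ y ∈ Icc a b, dist (f x) (f y) ≤
      dist (∫ t in a..x, ‖g t‖) (∫ t in a..y, ‖g t‖) := by
    have key : ∀ x ∈ Icc a b, ∀ y ∈ Icc a b, x ≤ y → dist (f x) (f y) ≤
        dist (∫ t in a..x, ‖g t‖) (∫ t in a..y, ‖g t‖) := by
      intro x hx y hy hxy
      have ha : a ∈ Icc a b := ⟨le_rfl, hab⟩
      rw [dist_comm, dist_eq_norm, hfg x hx y hy hxy, dist_comm, Real.dist_eq,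
        intervalIntegral.integral_interval_sub_left (hsub a ha y hy) (hsub a ha x hx)]
      exact (intervalIntegral.norm_integral_le_integral_norm hxy).trans (le_abs_self _)
    intro x hx y hy
    rcases le_total x y with h | h
    · exact key x hx y hy h
    · rw [dist_comm, dist_comm (∫ t in a..x, ‖g t‖)]; exact key y hy x hx h
  have hN : AbsolutelyContinuousOnInterval (fun x => ‖f x‖) a b := by
    refine hΦ.of_dist_le (C := 1) fun x hx y hy => ?_
    rw [uIcc_of_le hab] at hx hy
    rw [one_mul]
    exact (dist_norm_norm_le _ _).trans (by rw [← dist_eq_norm]; exact hdist x hx y hy)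
  obtain ⟨C, hC⟩ := isCompact_Icc.exists_bound_of_continuousOn hf
  -- G is only locally Lipschitz, which suffices because |f| is bounded on [a, b].
  obtain ⟨K, hK⟩ : ∃ K, LipschitzOnWith K G (Icc 0 C) := by
    have hG1 : ContDiff ℝ 1 G := contDiff_one_iff_deriv.2
      ⟨fun t => (hG t).differentiableAt, by
        have : deriv G = F := by ext t; exact (hG t).deriv
        rwa [this]⟩
    exact hG1.contDiffOn.exists_lipschitzOnWith (by norm_num) (convex_Icc _ _) isCompact_Icc
  have hH : AbsolutelyContinuousOnInterval (fun x => G ‖f x‖) a b := by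
    refine hN.of_dist_le (C := K) fun x hx y hy => ?_
    rw [uIcc_of_le hab] at hx hy
    exact hK.dist_le_mul _ ⟨norm_nonneg _, hC x hx⟩ _ ⟨norm_nonneg _, hC y hy⟩
  rw [← hH.integral_deriv_eq_sub, ← Real.norm_eq_abs]
  refine intervalIntegral.norm_integral_le_of_norm_le hab ?_ ?_
  · have hnb : ∀ᵐ x : ℝ, x ≠ b := by simp [ae_iff, measure_singleton]
    filter_upwards [hN.ae_differentiableAt, hgi.ae_hasDerivAt_integral, hnb] with x h1 h2 hxb hx
    have hx' : x ∈ Icc a b := Ioc_subset_Icc_self hx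
    have hxu : x ∈ uIcc a b := by rwa [uIcc_of_le hab]
    have hfd : HasDerivAt f (g x) x := by
      have h3 := (h2 hxu a (by simp)).const_add (f a)
      refine h3.congr_of_eventuallyEq ?_
      filter_upwards [Icc_mem_nhds hx.1 (lt_of_le_of_ne hx.2 hxb)] with y hy
      rw [← hfg a ⟨le_rfl, hab⟩ y hy hy.1]
      ring
    have h4 := (hG ‖f x‖).comp x (h1 hxu).hasDerivAt
    have h5 : deriv (fun x => G ‖f x‖) x = F ‖f x‖ * deriv (fun y => ‖f y‖) x := h4.deriv
    rw [h5, norm_mul, Real.norm_of_nonneg (hF0 _)]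
    exact mul_le_mul_of_nonneg_left (abs_deriv_norm_le hfd (h1 hxu)) (hF0 _)
  · refine IntervalIntegrable.continuousOn_mul hgn ?_
    rw [uIcc_of_le hab]
    exact hF.comp_continuousOn hf.norm

/-- Cauchy-Schwarz, obtained by expanding the variance of |g|. -/
lemma sq_integral_norm_le {g : ℝ → ℂ} {a b : ℝ} (hab : a < b)
    (hg : IntegrableOn g (Icc a b)) (hg2 : IntegrableOn (fun x => ‖g x‖ ^ 2) (Icc a b)) :
    (∫ x in Icc a b, ‖g x‖) ^ 2 ≤ (b - a) * ∫ x in Icc a b, ‖g x‖ ^ 2 := by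
  have hl : 0 < b - a := by linarith
  set s := ∫ x in Icc a b, ‖g x‖ with hs
  have hg1 : IntegrableOn (fun x => ‖g x‖) (Icc a b) := hg.norm
  have hconst : IntegrableOn (fun _ : ℝ => (s / (b - a)) ^ 2) (Icc a b) := by
    simp [integrableOn_const_iff]
  have h0 : 0 ≤ ∫ x in Icc a b, (‖g x‖ - s / (b - a)) ^ 2 := integral_nonneg fun x => sq_nonneg _
  have e : ∫ x in Icc a b, (‖g x‖ - s / (b - a)) ^ 2
      = (∫ x in Icc a b, ‖g x‖ ^ 2) - 2 * (s / (b - a)) * s + (s / (b - a)) ^ 2 * (b - a) := by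
    have : ∀ x, (‖g x‖ - s / (b - a)) ^ 2
        = ‖g x‖ ^ 2 - 2 * (s / (b - a)) * ‖g x‖ + (s / (b - a)) ^ 2 := fun x => by ring
    simp only [this]
    have hd : IntegrableOn (fun x => ‖g x‖ ^ 2 - 2 * (s / (b - a)) * ‖g x‖) (Icc a b) :=
      hg2.sub (hg1.const_mul _)
    rw [integral_add hd hconst, integral_sub hg2 (hg1.const_mul _),
      integral_const_mul, setIntegral_const, ← hs]
    simp [Real.volume_real_Icc_of_le hab.le, mul_comm]
  rw [e] at h0
  have h1 : (∫ x in Icc a b, ‖g x‖ ^ 2) - 2 * (s / (b - a)) * s + (s / (b - a)) ^ 2 * (b - a)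
      = (∫ x in Icc a b, ‖g x‖ ^ 2) - s ^ 2 / (b - a) := by field_simp; ring
  rw [h1, sub_nonneg, div_le_iff₀ hl] at h0
  linarith

/-- A pointwise bound of a function by its `H¹` norm on an interval. -/
lemma sq_norm_le_of_primitive {f g : ℝ → ℂ} {a b : ℝ} (hab : a < b)
    (hf : ContinuousOn f (Icc a b)) (hg : IntegrableOn g (Icc a b))
    (hg2 : IntegrableOn (fun x => ‖g x‖ ^ 2) (Icc a b))
    (hfg : ∀ x ∈ Icc a b, ∀ y ∈ Icc a b, x ≤ y → f y - f x = ∫ t in x..y, g t)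
    {x : ℝ} (hx : x ∈ Icc a b) :
    ‖f x‖ ^ 2 ≤ 2 / (b - a) * (∫ y in Icc a b, ‖f y‖ ^ 2) +
      2 * (b - a) * ∫ y in Icc a b, ‖g y‖ ^ 2 := by
  have hl : 0 < b - a := by linarith
  have hcs := sq_integral_norm_le hab hg hg2
  set s := ∫ x in Icc a b, ‖g x‖ with hs
  set A := ∫ x in Icc a b, ‖g x‖ ^ 2 with hA
  have hosc : ∀ z ∈ Icc a b, ∀ y ∈ Icc a b, z ≤ y → ‖f y - f z‖ ≤ s := by
    intro z hz y hy hzy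
    rw [hfg z hz y hy hzy]
    refine (intervalIntegral.norm_integral_le_integral_norm hzy).trans ?_
    rw [intervalIntegral.integral_of_le hzy]
    exact setIntegral_mono_set hg.norm (ae_of_all _ fun _ => norm_nonneg _)
      (LE.le.eventuallyLE fun t ht => ⟨hz.1.trans ht.1.le, ht.2.trans hy.2⟩)
  -- The oscillation of f is at most the integral of |g|. Averaging this bound over y gives the
  -- claim.
  have hpt : ∀ y ∈ Icc a b, ‖f x‖ ^ 2 ≤ 2 * ‖f y‖ ^ 2 + 2 * ((b - a) * A) := by
    intro y hy
    have h1 : ‖f x‖ ≤ ‖f y‖ + s := by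
      have : ‖f x - f y‖ ≤ s := by
        rcases le_total x y with h | h
        · rw [norm_sub_rev]; exact hosc x hx y hy h
        · exact hosc y hy x hx h
      have h2 := norm_sub_norm_le (f x) (f y)
      linarith
    have hs0 : 0 ≤ s := integral_nonneg fun _ => norm_nonneg _
    nlinarith [norm_nonneg (f x), norm_nonneg (f y), sq_nonneg (‖f y‖ - s)]
  have hfi : IntegrableOn (fun y => ‖f y‖ ^ 2) (Icc a b) :=
    (hf.norm.pow 2).integrableOn_compact isCompact_Icc
  have hc : ∀ c : ℝ, IntegrableOn (fun _ : ℝ => c) (Icc a b) := fun c => by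
    simp [integrableOn_const_iff]
  have hmono := setIntegral_mono_on (hc (‖f x‖ ^ 2)) ((hfi.const_mul 2).add (hc (2 * ((b - a) * A))))
    measurableSet_Icc hpt
  simp only [Pi.add_apply] at hmono
  rw [integral_add (hfi.const_mul 2) (hc _), setIntegral_const, setIntegral_const,
    integral_const_mul, Real.volume_real_Icc_of_le hab.le, smul_eq_mul, smul_eq_mul] at hmono
  have : 2 / (b - a) * (∫ y in Icc a b, ‖f y‖ ^ 2) + 2 * (b - a) * A
      = (2 * (∫ y in Icc a b, ‖f y‖ ^ 2) + (b - a) * (2 * ((b - a) * A))) / (b - a) := by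
    field_simp
  rw [this, le_div_iff₀ hl]
  linarith

/-- A function of class `H¹` on a halfline vanishes at infinity. -/
lemma tendsto_norm_zero_of_primitive {f g : ℝ → ℂ} {R : ℝ}
    (hf : ContinuousOn f (Ici R)) (hf2 : IntegrableOn (fun x => ‖f x‖ ^ 2) (Ici R))
    (hg : ∀ x y, R ≤ x → IntegrableOn g (Icc x y))
    (hg2 : IntegrableOn (fun x => ‖g x‖ ^ 2) (Ici R))
    (hfg : ∀ x y, R ≤ x → x ≤ y → f y - f x = ∫ t in x..y, g t) :
    Tendsto (fun x => ‖f x‖) atTop (𝓝 0) := by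
  have htail : ∀ h : ℝ → ℂ, IntegrableOn (fun x => ‖h x‖ ^ 2) (Ici R) →
      Tendsto (fun x => ∫ y in Icc x (x + 1), ‖h y‖ ^ 2) atTop (𝓝 0) := by
    intro h hh
    have h1 := intervalIntegral_tendsto_integral_Ioi R (hh.mono_set Ioi_subset_Ici_self) tendsto_id
    have h2 := intervalIntegral_tendsto_integral_Ioi R (hh.mono_set Ioi_subset_Ici_self)
      (tendsto_atTop_add_const_right atTop (1 : ℝ) tendsto_id)
    have h3 := h2.sub h1
    rw [sub_self] at h3
    refine h3.congr' ?_
    filter_upwards [Ici_mem_atTop R] with x hx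
    have hi : ∀ y, R ≤ y → IntervalIntegrable (fun x => ‖h x‖ ^ 2) volume R y := fun y hy =>
      (intervalIntegrable_iff_integrableOn_Icc_of_le hy).2 (hh.mono_set Icc_subset_Ici_self)
    simp only [id]
    rw [intervalIntegral.integral_interval_sub_left (hi _ (by linarith [mem_Ici.1 hx])) (hi _ hx),
      intervalIntegral.integral_of_le (by linarith), integral_Icc_eq_integral_Ioc]
  have hlim := ((htail f hf2).const_mul 2).add ((htail g hg2).const_mul 2)
  simp only [mul_zero, add_zero] at hlim
  have hsq : Tendsto (fun x => ‖f x‖ ^ 2) atTop (𝓝 0) := by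
    refine squeeze_zero' (Eventually.of_forall fun x => sq_nonneg _) ?_ hlim
    filter_upwards [Ici_mem_atTop R] with x hx
    have hsub : Icc x (x + 1) ⊆ Ici R := fun y hy => le_trans hx hy.1
    have := sq_norm_le_of_primitive (a := x) (b := x + 1) (by linarith) (hf.mono hsub)
      (hg x _ hx) (hg2.mono_set hsub) (fun z hz y hy hzy => hfg z y (hsub hz) hzy)
      (x := x) ⟨le_rfl, by linarith⟩
    simpa using this
  have := hsq.sqrt
  simpa [Real.sqrt_sq (norm_nonneg _)] using this

/-- A positive value confines the search to a compact interval; if there is none, N vanishes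
identically. -/
lemma exists_max_of_tendsto_zero {N : ℝ → ℝ} {R : ℝ} (hN : ContinuousOn N (Ici R))
    (h0 : ∀ x, 0 ≤ N x) (hlim : Tendsto N atTop (𝓝 0)) :
    ∃ x₀ ∈ Ici R, ∀ x ∈ Ici R, N x ≤ N x₀ := by
  by_cases h : ∃ x ∈ Ici R, 0 < N x
  · obtain ⟨x, hx, hpos⟩ := h
    refine hN.exists_isMaxOn' isClosed_Ici hx ?_
    obtain ⟨b, hb⟩ := eventually_atTop.1 (hlim.eventually_lt_const hpos)
    rw [eventually_inf_principal]
    filter_upwards [isCompact_Icc.compl_mem_cocompact (s := Icc R b)] with y hy hyR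
    refine (hb y ?_).le
    by_contra hlt
    exact hy ⟨hyR, by linarith⟩
  · push Not at h
    exact ⟨R, self_mem_Ici, fun x hx => (h x hx).trans (h0 R)⟩

/-- The action of a function on a halfline bounds the variation of `solitonAction` along it. -/
lemma two_mul_solitonAction_sub_le {p M R x₀ : ℝ} (hp : 2 < p) {f g : ℝ → ℂ}
    (hx₀ : R ≤ x₀) (hf : ContinuousOn f (Ici R))
    (hlim : Tendsto (fun x => ‖f x‖) atTop (𝓝 0))
    (hF : IntegrableOn (fun x => solitonSlope p M ‖f x‖ ^ 2) (Ioi R))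
    (hg : ∀ x y, R ≤ x → IntegrableOn g (Icc x y))
    (hg2 : IntegrableOn (fun x => ‖g x‖ ^ 2) (Ioi R))
    (hfg : ∀ x y, R ≤ x → x ≤ y → f y - f x = ∫ t in x..y, g t) :
    2 * solitonAction p M ‖f x₀‖ - solitonAction p M ‖f R‖ ≤
      ∫ x in Ioi R, (1 / 2 * ‖g x‖ ^ 2 + 1 / 2 * solitonSlope p M ‖f x‖ ^ 2) := by
  have p0 : 0 ≤ p := by linarith
  have hcont := continuous_solitonSlope p0 M
  set h : ℝ → ℝ := fun x => 1 / 2 * ‖g x‖ ^ 2 + 1 / 2 * solitonSlope p M ‖f x‖ ^ 2 with hh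
  have hint : IntegrableOn h (Ioi R) := (hg2.const_mul _).add (hF.const_mul _)
  have hi : ∀ a b, R ≤ a → a ≤ b → IntervalIntegrable h volume a b := fun a b ha hab =>
    (intervalIntegrable_iff_integrableOn_Ioc_of_le hab).2
      (hint.mono_set fun t ht => lt_of_le_of_lt ha ht.1)
  have hvar : ∀ a b, R ≤ a → a ≤ b →
      |solitonAction p M ‖f b‖ - solitonAction p M ‖f a‖| ≤ ∫ x in a..b, h x := by
    intro a b ha hab
    have hsub : Icc a b ⊆ Ici R := fun t ht => ha.trans ht.1
    refine (abs_comp_norm_sub_le hab hcont (solitonSlope_nonneg p M)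
      (hasDerivAt_solitonAction p0 M) (hf.mono hsub) (hg a b ha)
      (fun x hx y _ hxy => hfg x y (hsub hx) hxy)).trans ?_
    refine intervalIntegral.integral_mono_on hab ?_ (hi a b ha hab) fun x _ => ?_
    · refine IntervalIntegrable.continuousOn_mul
        ((intervalIntegrable_iff_integrableOn_Icc_of_le hab).2 (hg a b ha)).norm ?_
      rw [uIcc_of_le hab]
      exact hcont.comp_continuousOn (hf.mono hsub).norm
    · simp only [hh]
      -- The calibration inequality ab ≤ (a² + b²)/2, an equality exactly when |f'| is the soliton
      -- slope.
      nlinarith [sq_nonneg (solitonSlope p M ‖f x‖ - ‖g x‖)]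
  have hle : ∀ b, x₀ ≤ b → 2 * solitonAction p M ‖f x₀‖ - solitonAction p M ‖f R‖
      - solitonAction p M ‖f b‖ ≤ ∫ x in Ioi R, h x := by
    intro b hb
    -- The action rises from R to x₀ and falls from x₀ to b, whence the factor 2.
    have h1 := (le_abs_self _).trans (hvar R x₀ le_rfl hx₀)
    have h2 := (neg_le_abs _).trans (hvar x₀ b hx₀ hb)
    have h3 := intervalIntegral.integral_add_adjacent_intervals (hi R x₀ le_rfl hx₀)
      (hi x₀ b hx₀ hb)
    have h4 : ∫ x in R..b, h x ≤ ∫ x in Ioi R, h x := by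
      rw [intervalIntegral.integral_of_le (hx₀.trans hb)]
      refine setIntegral_mono_set hint (ae_of_all _ fun x => ?_)
        (LE.le.eventuallyLE Ioc_subset_Ioi_self)
      simp only [hh, Pi.zero_apply]
      positivity
    linarith
  have hl : Tendsto (fun b => 2 * solitonAction p M ‖f x₀‖ - solitonAction p M ‖f R‖
      - solitonAction p M ‖f b‖) atTop
      (𝓝 (2 * solitonAction p M ‖f x₀‖ - solitonAction p M ‖f R‖ - 0)) := by
    refine tendsto_const_nhds.sub ?_
    have := (hasDerivAt_solitonAction p0 M 0).continuousAt.tendsto.comp hlim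
    simpa [Function.comp_def] using this
  rw [sub_zero] at hl
  refine le_of_tendsto hl ?_
  filter_upwards [Ici_mem_atTop x₀] with b hb using hle b hb

/-- Interpolation between the uniform norm and L², from the pointwise bound |f|^p ≤ B^(p-2) |f|². -/
lemma integrableOn_rpow_of_bound {f : ℝ → ℂ} {I : Set ℝ} {p B : ℝ} (hp : 2 < p)
    (hI : MeasurableSet I) (hf : MemLp f 2 (volume.restrict I)) (hB : ∀ x ∈ I, ‖f x‖ ≤ B) :
    IntegrableOn (fun x => ‖f x‖ ^ p) I ∧
      ∫ x in I, ‖f x‖ ^ p ≤ B ^ (p - 2) * ∫ x in I, ‖f x‖ ^ 2 := by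
  have hf2 : IntegrableOn (fun x => ‖f x‖ ^ 2) I :=
    (memLp_two_iff_integrable_sq_norm hf.aestronglyMeasurable).1 hf
  have hle : ∀ x ∈ I, ‖f x‖ ^ p ≤ B ^ (p - 2) * ‖f x‖ ^ 2 := fun x hx => by
    have h1 : ‖f x‖ ^ p = ‖f x‖ ^ (p - 2) * ‖f x‖ ^ 2 := by
      rw [← Real.rpow_two, ← Real.rpow_add_of_nonneg (norm_nonneg _) (by linarith) (by norm_num)]
      ring_nf
    rw [h1]
    exact mul_le_mul_of_nonneg_right
      (Real.rpow_le_rpow (norm_nonneg _) (hB x hx) (by linarith)) (sq_nonneg _)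
  have hint : IntegrableOn (fun x => ‖f x‖ ^ p) I := by
    refine Integrable.mono' (hf2.const_mul (B ^ (p - 2))) ?_ ?_
    · exact (Real.continuous_rpow_const (by linarith : 0 ≤ p)).comp_aestronglyMeasurable
        hf.aestronglyMeasurable.norm
    · refine (ae_restrict_mem hI).mono fun x hx => ?_
      rw [Real.norm_of_nonneg (Real.rpow_nonneg (norm_nonneg _) _)]
      exact hle x hx
  refine ⟨hint, ?_⟩
  rw [← integral_const_mul]
  exact setIntegral_mono_on hint (hf2.const_mul _) hI hle

/-! ### Functions of class H¹ on a graph: pointwise bounds and decay along the halflines. -/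

namespace MetricGraph

variable {V E : Type*} {G : MetricGraph V E}

lemma interval_of_eq_top {e : E} (h : G.length e = ⊤) : G.interval e = Ici 0 := by
  ext x; simp [interval, h]

lemma interval_of_ne_top {e : E} (h : G.length e ≠ ⊤) :
    G.interval e = Icc 0 (G.length e).toReal := by
  ext x
  simp only [interval, mem_ofPred_eq, mem_Icc]
  refine and_congr_right fun _ => ?_
  rw [ENNReal.ofReal_le_iff_le_toReal h]

lemma measurableSet_interval (e : E) : MeasurableSet (G.interval e) := by
  by_cases h : G.length e = ⊤
  · rw [interval_of_eq_top h]; exact measurableSet_Ici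
  · rw [interval_of_ne_top h]; exact measurableSet_Icc

lemma Icc_subset_interval {e : E} {x y : ℝ} (hx : x ∈ G.interval e) (hy : y ∈ G.interval e) :
    Icc x y ⊆ G.interval e := fun _ hz =>
  ⟨hx.1.trans hz.1, (ENNReal.ofReal_le_ofReal hz.2).trans hy.2⟩

lemma zero_mem_interval (e : E) : (0 : ℝ) ∈ G.interval e := ⟨le_rfl, by simp⟩

/-- Edges of length zero are points and carry no mass. No uniform bound is available on them, so
they are set aside throughout. -/
lemma restrict_interval_of_eq_zero {e : E} (h : G.length e = 0) :
    volume.restrict (G.interval e) = 0 := by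
  rw [interval_of_ne_top (by simp [h]), h]
  simp

namespace H1

variable (u : G.H1) (e : E)

lemma integrableOn_sq : IntegrableOn (fun x => ‖u.toFun e x‖ ^ 2) (G.interval e) :=
  (memLp_two_iff_integrable_sq_norm (u.memLp e).aestronglyMeasurable).1 (u.memLp e)

lemma integrableOn_der_sq : IntegrableOn (fun x => ‖u.der e x‖ ^ 2) (G.interval e) :=
  (memLp_two_iff_integrable_sq_norm (u.memLp_der e).aestronglyMeasurable).1 (u.memLp_der e)

variable {e}

lemma integrableOn_der {x y : ℝ} (hx : x ∈ G.interval e) (hy : y ∈ G.interval e) :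
    IntegrableOn (u.der e) (Icc x y) := by
  have h1 : MemLp (u.der e) 2 (volume.restrict (Icc x y)) :=
    (u.memLp_der e).mono_measure (Measure.restrict_mono (Icc_subset_interval hx hy) le_rfl)
  exact h1.integrable one_le_two

lemma sub_eq_integral {x y : ℝ} (hx : x ∈ G.interval e) (hy : y ∈ G.interval e) (hxy : x ≤ y) :
    u.toFun e y - u.toFun e x = ∫ t in x..y, u.der e t :=
  (u.hasWeakDeriv e).sub_eq_integral (measurableSet_interval e) hxy (Icc_subset_interval hx hy)
    ((u.continuousOn e).mono (Icc_subset_interval hx hy)) (u.integrableOn_der hx hy)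

lemma sq_norm_le {ε x : ℝ} (hε : 0 < ε) (hεe : ENNReal.ofReal ε ≤ G.length e)
    (hx : x ∈ G.interval e) :
    ‖u.toFun e x‖ ^ 2 ≤ 2 / ε * (∫ y in G.interval e, ‖u.toFun e y‖ ^ 2) +
      2 * ε * ∫ y in G.interval e, ‖u.der e y‖ ^ 2 := by
  -- A window of length ε around x within the edge: to the right of x if it fits, otherwise at the
  -- far end of the edge.
  obtain ⟨a, ha, hb, hxa⟩ : ∃ a, a ∈ G.interval e ∧ a + ε ∈ G.interval e ∧ x ∈ Icc a (a + ε) := by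
    by_cases h : G.length e = ⊤
    · rw [interval_of_eq_top h] at hx ⊢
      exact ⟨x, hx, by have := mem_Ici.1 hx; exact mem_Ici.2 (by linarith), le_rfl, by linarith⟩
    · have hε' : ε ≤ (G.length e).toReal := (ENNReal.ofReal_le_iff_le_toReal h).1 hεe
      rw [interval_of_ne_top h] at hx ⊢
      rcases le_total (x + ε) (G.length e).toReal with h1 | h1
      · exact ⟨x, hx, ⟨by linarith [hx.1], h1⟩, le_rfl, by linarith⟩
      · exact ⟨(G.length e).toReal - ε, ⟨by linarith, by linarith⟩, ⟨by linarith, by linarith⟩,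
          by linarith, by linarith [hx.2]⟩
  have hsub := Icc_subset_interval ha hb
  have h := sq_norm_le_of_primitive (a := a) (b := a + ε) (by linarith)
    ((u.continuousOn e).mono hsub) (u.integrableOn_der ha hb) ((u.integrableOn_der_sq e).mono_set hsub)
    (fun z hz y hy hzy => u.sub_eq_integral (hsub hz) (hsub hy) hzy) hxa
  rw [add_sub_cancel_left] at h
  refine h.trans (add_le_add ?_ ?_)
  · exact mul_le_mul_of_nonneg_left (setIntegral_mono_set (u.integrableOn_sq e)
      (ae_of_all _ fun _ => sq_nonneg _) (LE.le.eventuallyLE hsub)) (by positivity)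
  · exact mul_le_mul_of_nonneg_left (setIntegral_mono_set (u.integrableOn_der_sq e)
      (ae_of_all _ fun _ => sq_nonneg _) (LE.le.eventuallyLE hsub)) (by positivity)

variable (e) in
lemma exists_bound : ∃ B, ∀ x ∈ G.interval e, ‖u.toFun e x‖ ≤ B := by
  by_cases h : G.length e = ⊤
  · refine ⟨_, fun x hx => Real.le_sqrt_of_sq_le (u.sq_norm_le one_pos ?_ hx)⟩
    simp [h]
  · have := u.continuousOn e
    rw [interval_of_ne_top h] at this ⊢
    exact isCompact_Icc.exists_bound_of_continuousOn this

variable (e) in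
lemma integrableOn_rpow {p : ℝ} (hp : 2 < p) :
    IntegrableOn (fun x => ‖u.toFun e x‖ ^ p) (G.interval e) := by
  obtain ⟨B, hB⟩ := u.exists_bound e
  exact (integrableOn_rpow_of_bound hp (measurableSet_interval e) (u.memLp e) hB).1

lemma tendsto_norm_atTop (h : G.length e = ⊤) :
    Tendsto (fun x => ‖u.toFun e x‖) atTop (𝓝 0) := by
  have hI := interval_of_eq_top h
  have hmem : ∀ x, 0 ≤ x → x ∈ G.interval e := fun x hx => by rw [hI]; exact hx
  refine tendsto_norm_zero_of_primitive (R := 0) (g := u.der e) ?_ ?_ ?_ ?_ ?_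
  · rw [← hI]; exact u.continuousOn e
  · rw [← hI]; exact u.integrableOn_sq e
  · intro x y hx
    rcases le_total x y with hxy | hxy
    · exact u.integrableOn_der (hmem x hx) (hmem y (hx.trans hxy))
    · rcases hxy.eq_or_lt with rfl | hlt
      · exact u.integrableOn_der (hmem _ hx) (hmem _ hx)
      · simp [Icc_eq_empty_of_lt hlt]
  · rw [← hI]; exact u.integrableOn_der_sq e
  · exact fun x y hx hxy => u.sub_eq_integral (hmem x hx) (hmem y (hx.trans hxy)) hxy

end H1

/-! ### Gagliardo-Nirenberg bounds and coercivity of the energy. -/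

variable [Fintype E]

/-- The kinetic term `‖u'‖²`. -/
noncomputable def kinetic (u : G.H1) : ℝ := ∑ e, ∫ x in G.interval e, ‖u.der e x‖ ^ 2

/-- The potential term `‖u‖_p^p`. -/
noncomputable def potential (p : ℝ) (u : G.H1) : ℝ :=
  ∑ e, ∫ x in G.interval e, ‖u.toFun e x‖ ^ p

lemma energy_eq (p : ℝ) (u : G.H1) :
    energy p u = 1 / 2 * kinetic u - 1 / p * potential p u := rfl

lemma kinetic_nonneg (u : G.H1) : 0 ≤ kinetic u :=
  Finset.sum_nonneg fun _ _ => integral_nonneg fun _ => sq_nonneg _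

lemma mass_nonneg (u : G.H1) : 0 ≤ mass u :=
  Finset.sum_nonneg fun _ _ => integral_nonneg fun _ => sq_nonneg _

variable (G) in
-- Since there are finitely many edges, one window length fits into all the nondegenerate ones. This
-- makes the pointwise bound uniform over edges.
lemma exists_pos_le_length :
    ∃ ε : ℝ, 0 < ε ∧ ∀ e, G.length e ≠ 0 → ENNReal.ofReal ε ≤ G.length e := by
  have h1 : ∀ e, ∃ ε : ℝ, 0 < ε ∧ (G.length e ≠ 0 → ENNReal.ofReal ε ≤ G.length e) := by
    intro e
    by_cases h0 : G.length e = 0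
    · exact ⟨1, one_pos, fun h => absurd h0 h⟩
    by_cases h : G.length e = ⊤
    · exact ⟨1, one_pos, fun _ => by simp [h]⟩
    · exact ⟨(G.length e).toReal, ENNReal.toReal_pos h0 h, fun _ => ENNReal.ofReal_toReal_le⟩
  choose δ hδ0 hδ using h1
  rcases isEmpty_or_nonempty E with _ | _
  · exact ⟨1, one_pos, fun e => isEmptyElim e⟩
  obtain ⟨e₀, _, he₀⟩ := Finset.exists_min_image Finset.univ δ Finset.univ_nonempty
  exact ⟨δ e₀, hδ0 e₀, fun e he => (ENNReal.ofReal_le_ofReal (he₀ e (Finset.mem_univ e))).trans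
    (hδ e he)⟩

variable (G) in
/-- The Gagliardo-Nirenberg inequality in the uniform norm. -/
lemma exists_sq_norm_le {μ : ℝ} (hμ : 0 ≤ μ) : ∃ K : ℝ, 0 ≤ K ∧ ∀ u ∈ G.H1mu μ, ∀ e,
    G.length e ≠ 0 → ∀ x ∈ G.interval e, ‖u.toFun e x‖ ^ 2 ≤ K * √(1 + kinetic u) := by
  obtain ⟨ε₀, hε₀, hlen⟩ := G.exists_pos_le_length
  refine ⟨2 * μ / ε₀ + 2 * ε₀, by positivity, fun u hu e he x hx => ?_⟩
  have hk := kinetic_nonneg u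
  set y := √(1 + kinetic u) with hy
  have hy2 : y ^ 2 = 1 + kinetic u := Real.sq_sqrt (by linarith)
  have hy1 : 1 ≤ y := Real.one_le_sqrt.2 (by linarith)
  have hy0 : 0 < y := by linarith
  -- The window shrinks like the inverse square root of the kinetic term, which balances both terms
  -- of the bound; y ≥ 1 guarantees that it fits.
  have h := u.sq_norm_le (ε := ε₀ / y) (by positivity)
    ((ENNReal.ofReal_le_ofReal (div_le_self hε₀.le hy1)).trans (hlen e he)) hx
  have hm : ∫ y in G.interval e, ‖u.toFun e y‖ ^ 2 ≤ μ := by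
    rw [← show mass u = μ from hu]
    exact Finset.single_le_sum (f := fun e => ∫ y in G.interval e, ‖u.toFun e y‖ ^ 2)
      (fun _ _ => integral_nonneg fun _ => sq_nonneg _) (Finset.mem_univ e)
  have hd : ∫ y in G.interval e, ‖u.der e y‖ ^ 2 ≤ y ^ 2 := by
    have : ∫ y in G.interval e, ‖u.der e y‖ ^ 2 ≤ kinetic u :=
      Finset.single_le_sum (f := fun e => ∫ y in G.interval e, ‖u.der e y‖ ^ 2)
        (fun _ _ => integral_nonneg fun _ => sq_nonneg _) (Finset.mem_univ e)
    linarith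
  calc _ ≤ _ := h
    _ ≤ 2 / (ε₀ / y) * μ + 2 * (ε₀ / y) * y ^ 2 := by gcongr
    _ = _ := by field_simp

/-- A power below one is eventually at most (1 + k)/4, and then k/2 - (1 + k)/4 ≤ C forces k ≤ 4C +
1. It is applied with γ = (p - 2)/4, which is where `p < 6` enters. -/
lemma exists_le_of_sub_rpow_le {K γ C : ℝ} (hγ : γ < 1) :
    ∃ A : ℝ, ∀ k : ℝ, 0 ≤ k → 1 / 2 * k - K * (1 + k) ^ γ ≤ C → k ≤ A := by
  have h1 : Tendsto (fun y : ℝ => K * y ^ (-(1 - γ))) atTop (𝓝 (K * 0)) :=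
    (tendsto_rpow_neg_atTop (by linarith)).const_mul K
  rw [mul_zero] at h1
  obtain ⟨Y, hY⟩ := eventually_atTop.1 (h1.eventually_le_const (show (0 : ℝ) < 1 / 4 by norm_num))
  refine ⟨max Y (4 * C + 1), fun k hk h => ?_⟩
  by_contra! hlt
  have h2 : Y ≤ 1 + k := by linarith [(le_max_left Y (4 * C + 1)).trans hlt.le]
  have h3 := hY _ h2
  have h4 : K * (1 + k) ^ γ = K * (1 + k) ^ (-(1 - γ)) * (1 + k) := by
    rw [mul_assoc, ← Real.rpow_add_one (by positivity)]
    ring_nf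
  have h5 : K * (1 + k) ^ γ ≤ 1 / 4 * (1 + k) := by
    rw [h4]; exact mul_le_mul_of_nonneg_right h3 (by linarith)
  have := (le_max_right Y (4 * C + 1)).trans_lt hlt
  linarith

variable (G) in
/-- The energy is bounded below by a function of the kinetic term growing at infinity. -/
lemma exists_energy_ge {p μ : ℝ} (hp₂ : 2 < p) (hμ : 0 ≤ μ) :
    ∃ K : ℝ, 0 ≤ K ∧ ∀ u ∈ G.H1mu μ,
      1 / 2 * kinetic u - K * (1 + kinetic u) ^ ((p - 2) / 4) ≤ energy p u := by
  obtain ⟨K, hK, hbd⟩ := G.exists_sq_norm_le hμ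
  have p0 : 0 < p := by linarith
  refine ⟨1 / p * (K ^ ((p - 2) / 2) * μ), by positivity, fun u hu => ?_⟩
  have hk := kinetic_nonneg u
  have hpot : potential p u ≤ √(K * √(1 + kinetic u)) ^ (p - 2) * μ := by
    rw [← show mass u = μ from hu, mass, Finset.mul_sum]
    refine Finset.sum_le_sum fun e _ => ?_
    by_cases he : G.length e = 0
    · simp [restrict_interval_of_eq_zero he]
    · exact (integrableOn_rpow_of_bound hp₂ (measurableSet_interval e) (u.memLp e)
        fun x hx => Real.le_sqrt_of_sq_le (hbd u hu e he x hx)).2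
  have hrw : √(K * √(1 + kinetic u)) ^ (p - 2)
      = K ^ ((p - 2) / 2) * (1 + kinetic u) ^ ((p - 2) / 4) := by
    rw [Real.sqrt_eq_rpow, Real.sqrt_eq_rpow, ← Real.rpow_mul (by positivity),
      Real.mul_rpow hK (by positivity), ← Real.rpow_mul (by positivity)]
    ring_nf
  rw [hrw] at hpot
  have := mul_le_mul_of_nonneg_left hpot (show 0 ≤ 1 / p by positivity)
  rw [energy_eq]
  linarith

variable (G) in
/-- On a sublevel of the energy, the kinetic term and the uniform norm are bounded. -/
lemma exists_bound_of_energy_le {p μ : ℝ} (hp₂ : 2 < p) (hp₆ : p < 6) (hμ : 0 ≤ μ) (C : ℝ) :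
    ∃ B : ℝ, 0 ≤ B ∧ ∀ u ∈ G.H1mu μ, energy p u ≤ C → kinetic u ≤ B ∧
      ∀ e, G.length e ≠ 0 → ∀ x ∈ G.interval e, ‖u.toFun e x‖ ≤ B := by
  obtain ⟨K, hK, hbd⟩ := G.exists_sq_norm_le hμ
  obtain ⟨K', _, hen⟩ := G.exists_energy_ge hp₂ hμ
  obtain ⟨A, hA⟩ := exists_le_of_sub_rpow_le (K := K') (γ := (p - 2) / 4) (C := C) (by linarith)
  refine ⟨max A (√(K * √(1 + A))), le_max_of_le_right (Real.sqrt_nonneg _), fun u hu hC => ?_⟩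
  have hk := hA _ (kinetic_nonneg u) ((hen u hu).trans hC)
  refine ⟨hk.trans (le_max_left _ _), fun e he x hx => le_max_of_le_right ?_⟩
  refine Real.le_sqrt_of_sq_le ((hbd u hu e he x hx).trans ?_)
  gcongr

variable (G) in
-- Only functions of nonpositive energy matter; their kinetic term is bounded, hence so is the
-- negative part of the energy.
lemma bddBelow_energy {p μ : ℝ} (hp₂ : 2 < p) (hp₆ : p < 6) (hμ : 0 ≤ μ) :
    BddBelow (energy p '' G.H1mu μ) := by
  obtain ⟨K, hK, hen⟩ := G.exists_energy_ge hp₂ hμ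
  obtain ⟨B, hB, hbd⟩ := G.exists_bound_of_energy_le hp₂ hp₆ hμ 0
  refine ⟨-(K * (1 + B) ^ ((p - 2) / 4)), ?_⟩
  rintro _ ⟨u, hu, rfl⟩
  have hpos : 0 ≤ K * (1 + B) ^ ((p - 2) / 4) := by positivity
  rcases le_total (energy p u) 0 with h | h
  · have h1 := hen u hu
    have hk := kinetic_nonneg u
    have h2 : (1 + kinetic u) ^ ((p - 2) / 4) ≤ (1 + B) ^ ((p - 2) / 4) :=
      Real.rpow_le_rpow (by positivity) (by linarith [(hbd u hu h).1]) (by linarith)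
    have := mul_le_mul_of_nonneg_left h2 hK
    linarith
  · linarith

/-! ### The energy of the tails on the halflines. -/

/-- The part of a function beyond distance `R` on the halflines has almost the energy of a function
on the line. -/
lemma lineLevel_sub_le_tail {p B R : ℝ} (hG : G.Noncompact) (hp₂ : 2 < p) (hp₆ : p < 6)
    (u : G.H1) (hB : ∀ e, G.length e ≠ 0 → ∀ x ∈ G.interval e, ‖u.toFun e x‖ ≤ B) (hR : 0 ≤ R)
    (hlen : ∀ e, G.length e ≠ ⊤ → (G.length e).toReal ≤ R) :
    lineLevel p (∑ e, ∫ x in G.interval e ∩ Ioi R, ‖u.toFun e x‖ ^ 2)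
        - √(2 / p * B ^ (p - 2)) / 2 * ∑ e with G.length e = ⊤, ‖u.toFun e R‖ ^ 2 ≤
      1 / 2 * (∑ e, ∫ x in G.interval e ∩ Ioi R, ‖u.der e x‖ ^ 2)
        - 1 / p * ∑ e, ∫ x in G.interval e ∩ Ioi R, ‖u.toFun e x‖ ^ p := by
  have p0 : 0 < p := by linarith
  have hmem : ∀ e, G.length e = ⊤ → ∀ x, R ≤ x → x ∈ G.interval e := fun e he x hx => by
    rw [interval_of_eq_top he]; exact hR.trans hx
  have htop : ∀ e, G.length e = ⊤ → G.interval e ∩ Ioi R = Ioi R := fun e he =>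
    inter_eq_right.2 fun x hx => hmem e he x (le_of_lt hx)
  have hfin : ∀ e, G.length e ≠ ⊤ → G.interval e ∩ Ioi R = ∅ := fun e he => by
    rw [interval_of_ne_top he]
    ext x
    simp only [mem_inter_iff, mem_Icc, mem_Ioi, mem_empty_iff_false, iff_false]
    rintro ⟨⟨_, h1⟩, h2⟩
    linarith [hlen e he]
  have hmax : ∀ e, ∃ x, G.length e = ⊤ → R ≤ x ∧ ∀ y, R ≤ y → ‖u.toFun e y‖ ≤ ‖u.toFun e x‖ := by
    intro e
    by_cases he : G.length e = ⊤
    · obtain ⟨x, hx, hmx⟩ := exists_max_of_tendsto_zero (N := fun x => ‖u.toFun e x‖) (R := R)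
        (((u.continuousOn e).mono (hmem e he)).norm) (fun _ => norm_nonneg _)
        (u.tendsto_norm_atTop he)
      exact ⟨x, fun _ => ⟨hx, hmx⟩⟩
    · exact ⟨0, fun h => absurd h he⟩
  choose X hX using hmax
  have hne : (Finset.univ.filter fun e => G.length e = ⊤).Nonempty := by
    obtain ⟨e, he⟩ := hG
    exact ⟨e, by simp [(G.length_eq_top_iff e).2 he]⟩
  obtain ⟨e₀, he₀, hmax₀⟩ := Finset.exists_max_image _ (fun e => ‖u.toFun e (X e)‖) hne
  simp only [Finset.mem_filter, Finset.mem_univ, true_and] at he₀ hmax₀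
  set M := ‖u.toFun e₀ (X e₀)‖ with hM
  have hM0 : 0 ≤ M := norm_nonneg _
  have hMB : M ≤ B := hB e₀ (by simp [he₀]) _ (hmem e₀ he₀ _ (hX e₀ he₀).1)
  have hle : ∀ e, G.length e = ⊤ → ∀ x, R ≤ x → ‖u.toFun e x‖ ≤ M := fun e he x hx =>
    ((hX e he).2 x hx).trans (hmax₀ e he)
  -- The multiple of the mass is chosen so that the integrand becomes half the sum of |u'|² and the
  -- squared slope. As |u| ≤ M on all tails, each T e is nonnegative, and only the halfline
  -- attaining M needs a finer bound.
  let T : E → ℝ := fun e => 1 / 2 * (∫ x in G.interval e ∩ Ioi R, ‖u.der e x‖ ^ 2)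
    + 1 / p * M ^ (p - 2) * (∫ x in G.interval e ∩ Ioi R, ‖u.toFun e x‖ ^ 2)
    - 1 / p * ∫ x in G.interval e ∩ Ioi R, ‖u.toFun e x‖ ^ p
  have hTtop : ∀ e, G.length e = ⊤ →
      IntegrableOn (fun x => solitonSlope p M ‖u.toFun e x‖ ^ 2) (Ioi R) ∧
      T e = ∫ x in Ioi R, (1 / 2 * ‖u.der e x‖ ^ 2 + 1 / 2 * solitonSlope p M ‖u.toFun e x‖ ^ 2) := by
    intro e he
    have hsub : Ioi R ⊆ G.interval e := fun x hx => hmem e he x (le_of_lt hx)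
    have i1 := (u.integrableOn_der_sq e).mono_set hsub
    have i2 := (u.integrableOn_sq e).mono_set hsub
    have i3 := (u.integrableOn_rpow e hp₂).mono_set hsub
    have hS : EqOn (fun x => 2 / p * M ^ (p - 2) * ‖u.toFun e x‖ ^ 2 - 2 / p * ‖u.toFun e x‖ ^ p)
        (fun x => solitonSlope p M ‖u.toFun e x‖ ^ 2) (Ioi R) := fun x hx =>
      (solitonSlope_sq hp₂ (norm_nonneg _) (hle e he x (le_of_lt hx))).symm
    have iS : IntegrableOn (fun x => solitonSlope p M ‖u.toFun e x‖ ^ 2) (Ioi R) :=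
      IntegrableOn.congr_fun ((i2.const_mul _).sub (i3.const_mul _)) hS measurableSet_Ioi
    refine ⟨iS, ?_⟩
    rw [integral_add (i1.const_mul _) (iS.const_mul _), integral_const_mul, integral_const_mul,
      ← setIntegral_congr_fun measurableSet_Ioi hS,
      integral_sub (i2.const_mul _) (i3.const_mul _), integral_const_mul, integral_const_mul]
    simp only [T, htop e he]
    ring
  have hT0 : ∀ e, 0 ≤ T e := by
    intro e
    by_cases he : G.length e = ⊤
    · rw [(hTtop e he).2]
      exact integral_nonneg fun x => by positivity
    · simp [T, hfin e he]
  have hTe₀ : 2 * solitonAction p M M - solitonAction p M ‖u.toFun e₀ R‖ ≤ T e₀ := by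
    rw [(hTtop e₀ he₀).2]
    refine two_mul_solitonAction_sub_le hp₂ (hX e₀ he₀).1 ((u.continuousOn e₀).mono (hmem e₀ he₀))
      (u.tendsto_norm_atTop he₀) (hTtop e₀ he₀).1 (fun x y hx => ?_)
      ((u.integrableOn_der_sq e₀).mono_set fun x hx => hmem e₀ he₀ x (le_of_lt hx))
      (fun x y hx hxy => u.sub_eq_integral (hmem e₀ he₀ x hx) (hmem e₀ he₀ y (hx.trans hxy)) hxy)
    rcases le_or_gt x y with hxy | hxy
    · exact u.integrableOn_der (hmem e₀ he₀ x hx) (hmem e₀ he₀ y (hx.trans hxy))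
    · simp [Icc_eq_empty_of_lt hxy]
  have hsum : T e₀ ≤ ∑ e, T e := Finset.single_le_sum (fun e _ => hT0 e) (Finset.mem_univ e₀)
  have hsumT : ∑ e, T e = 1 / 2 * (∑ e, ∫ x in G.interval e ∩ Ioi R, ‖u.der e x‖ ^ 2)
      + 1 / p * M ^ (p - 2) * (∑ e, ∫ x in G.interval e ∩ Ioi R, ‖u.toFun e x‖ ^ 2)
      - 1 / p * ∑ e, ∫ x in G.interval e ∩ Ioi R, ‖u.toFun e x‖ ^ p := by
    simp only [T, Finset.sum_sub_distrib, Finset.sum_add_distrib, Finset.mul_sum]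
  have hlevel := lineLevel_le (p := p) (M := M)
    (m := ∑ e, ∫ x in G.interval e ∩ Ioi R, ‖u.toFun e x‖ ^ 2) hp₂ hp₆ hM0
    (Finset.sum_nonneg fun _ _ => integral_nonneg fun _ => sq_nonneg _)
  have hend : solitonAction p M ‖u.toFun e₀ R‖ ≤
      √(2 / p * B ^ (p - 2)) / 2 * ∑ e with G.length e = ⊤, ‖u.toFun e R‖ ^ 2 := by
    have h1 := solitonAction_le (p := p) (M := M) hp₂ (norm_nonneg (u.toFun e₀ R))
    have h2 : √(2 / p * M ^ (p - 2)) ≤ √(2 / p * B ^ (p - 2)) := by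
      have := Real.rpow_le_rpow hM0 hMB (by linarith : 0 ≤ p - 2)
      gcongr
    have h3 : ‖u.toFun e₀ R‖ ^ 2 ≤ ∑ e with G.length e = ⊤, ‖u.toFun e R‖ ^ 2 :=
      Finset.single_le_sum (f := fun e => ‖u.toFun e R‖ ^ 2) (fun _ _ => sq_nonneg _)
        (by simp [he₀])
    calc _ ≤ _ := h1
      _ = √(2 / p * M ^ (p - 2)) / 2 * ‖u.toFun e₀ R‖ ^ 2 := by ring
      _ ≤ _ := by gcongr
  linarith

end MetricGraph

/-! ### Weak compactness -/

/-- Bounded sequences in `L²` have weakly convergent subsequences. -/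
lemma exists_subseq_tendsto_integral_mul {μ : Measure ℝ} [SFinite μ] {g : ℕ → ℝ → ℂ} {C : ℝ}
    (hg : ∀ n, MemLp (g n) 2 μ) (hC : ∀ n, ∫ x, ‖g n x‖ ^ 2 ∂μ ≤ C) :
    ∃ k : ℕ → ℕ, StrictMono k ∧ ∃ w, MemLp w 2 μ ∧ ∀ φ, MemLp φ 2 μ →
      Tendsto (fun n => ∫ x, φ x * g (k n) x ∂μ) atTop (𝓝 (∫ x, φ x * w x ∂μ)) := by
  have : Fact ((2 : ℝ≥0∞) ≠ ⊤) := ⟨by norm_num⟩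
  let X : ℕ → Lp ℂ 2 μ := fun n => (hg n).toLp
  have hX : ∀ n, ‖X n‖ ≤ √C := fun n => by
    refine Real.le_sqrt_of_sq_le ?_
    have h1 : ‖X n‖ ^ 2 = ∫ x, ‖g n x‖ ^ 2 ∂μ := by
      rw [norm_sq_eq_re_inner (𝕜 := ℂ), L2.inner_def, ← integral_re]
      · refine integral_congr_ae ((hg n).coeFn_toLp.mono fun x hx => ?_)
        simp only [X, hx]
        rw [← norm_sq_eq_re_inner (𝕜 := ℂ)]
      · exact L2.integrable_inner _ _
    rw [h1]; exact hC n
  -- Riesz representation moves the sequence to the dual, whose closed balls are weak-* sequentially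
  -- compact. The conjugations below turn inner products into bilinear integrals.
  let Y : ℕ → WeakDual ℂ (Lp ℂ 2 μ) := fun n =>
    StrongDual.toWeakDual (InnerProductSpace.toDual ℂ (Lp ℂ 2 μ) (X n))
  have hY : ∀ n, Y n ∈ WeakDual.toStrongDual ⁻¹'
      Metric.closedBall (0 : StrongDual ℂ (Lp ℂ 2 μ)) (√C) := fun n => by
    rw [mem_preimage, mem_closedBall_zero_iff]
    change ‖InnerProductSpace.toDual ℂ (Lp ℂ 2 μ) (X n)‖ ≤ _
    rw [LinearIsometryEquiv.norm_map]
    exact hX n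
  obtain ⟨ℓ, -, k, hk, hlim⟩ := WeakDual.isSeqCompact_closedBall ℂ (Lp ℂ 2 μ) 0 (√C) hY
  let w : Lp ℂ 2 μ := (InnerProductSpace.toDual ℂ (Lp ℂ 2 μ)).symm (WeakDual.toStrongDual ℓ)
  refine ⟨k, hk, w, Lp.memLp w, fun φ hφ => ?_⟩
  have hφ' : MemLp (fun x => (starRingEnd ℂ) (φ x)) 2 μ := hφ.star
  have h1 := ((WeakDual.eval_continuous (hφ'.toLp)).tendsto ℓ).comp hlim
  have h2 : ∀ (v : Lp ℂ 2 μ) (f : ℝ → ℂ), v =ᵐ[μ] f →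
      (starRingEnd ℂ) (inner ℂ v hφ'.toLp) = ∫ x, φ x * f x ∂μ := by
    intro v f hvf
    rw [L2.inner_def, ← integral_conj]
    refine integral_congr_ae ?_
    filter_upwards [hvf, hφ'.coeFn_toLp] with x hx1 hx2
    rw [hx1, hx2, RCLike.inner_apply]
    simp
  have h3 : ∀ n, Y n hφ'.toLp = inner ℂ (X n) hφ'.toLp := fun n =>
    InnerProductSpace.toDual_apply_apply ..
  have h4 : ℓ hφ'.toLp = inner ℂ w hφ'.toLp := by
    rw [← InnerProductSpace.toDual_apply_apply (𝕜 := ℂ), LinearIsometryEquiv.apply_symm_apply]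
    rfl
  have h5 := (Complex.continuous_conj.tendsto _).comp h1
  rw [h4, h2 w w (ae_eq_refl _)] at h5
  refine h5.congr fun n => ?_
  simp only [Function.comp_apply]
  rw [h3, h2 _ _ (hg (k n)).coeFn_toLp]

/-- Finitely many properties that can be achieved by passing to a subsequence, and are inherited by
subsequences, can be achieved simultaneously. -/
lemma exists_common_subseq {ι : Type*} [Fintype ι] {P : ι → (ℕ → ℕ) → Prop}
    (hex : ∀ i (k : ℕ → ℕ), StrictMono k → ∃ j : ℕ → ℕ, StrictMono j ∧ P i (k ∘ j))
    (hsub : ∀ i (k j : ℕ → ℕ), P i k → StrictMono j → P i (k ∘ j)) :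
    ∃ k : ℕ → ℕ, StrictMono k ∧ ∀ i, P i k := by
  classical
  suffices h : ∀ s : Finset ι, ∃ k : ℕ → ℕ, StrictMono k ∧ ∀ i ∈ s, P i k by
    obtain ⟨k, hk, h⟩ := h Finset.univ
    exact ⟨k, hk, fun i => h i (Finset.mem_univ i)⟩
  intro s
  induction s using Finset.induction_on with
  | empty => exact ⟨id, strictMono_id, by simp⟩
  | insert i s _ ih =>
    obtain ⟨k, hk, h⟩ := ih
    obtain ⟨j, hj, hP⟩ := hex i k hk
    refine ⟨k ∘ j, hk.comp hj, fun i' hi' => ?_⟩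
    rcases Finset.mem_insert.1 hi' with rfl | hi'
    · exact hP
    · exact hsub _ _ _ (h _ hi') hj

/-- Testing weak convergence of derivatives against this indicator yields pointwise convergence of
their primitives. -/
lemma integral_indicator_one_mul {I : Set ℝ} {x : ℝ} (hx : 0 ≤ x) (hI : Icc 0 x ⊆ I)
    (g : ℝ → ℂ) :
    ∫ t in I, (Ioc 0 x).indicator (fun _ => (1 : ℂ)) t * g t = ∫ t in (0 : ℝ)..x, g t := by
  have : ∀ t, (Ioc 0 x).indicator (fun _ => (1 : ℂ)) t * g t = (Ioc 0 x).indicator g t := by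
    intro t
    by_cases ht : t ∈ Ioc 0 x <;> simp [ht]
  simp only [this]
  rw [setIntegral_indicator measurableSet_Ioc,
    inter_eq_self_of_subset_right (Ioc_subset_Icc_self.trans hI),
    intervalIntegral.integral_of_le hx]

namespace MetricGraph

variable {V E : Type*} [Fintype V] [Fintype E] {G : MetricGraph V E}

/-- Weak compactness of bounded sets of `H¹(G)`. -/
lemma exists_subseq_tendsto {u : ℕ → G.H1} {B m : ℝ} (hB0 : 0 ≤ B)
    (hkin : ∀ n, kinetic (u n) ≤ B) (hmass : ∀ n, mass (u n) ≤ m)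
    (hB : ∀ n e, G.length e ≠ 0 → ∀ x ∈ G.interval e, ‖(u n).toFun e x‖ ≤ B) :
    ∃ k : ℕ → ℕ, StrictMono k ∧ ∃ v : G.H1,
      (∀ e, G.length e ≠ 0 → ∀ x ∈ G.interval e,
        Tendsto (fun n => (u (k n)).toFun e x) atTop (𝓝 (v.toFun e x))) ∧
      ∀ e φ, MemLp φ 2 (volume.restrict (G.interval e)) →
        Tendsto (fun n => ∫ x in G.interval e, φ x * (u (k n)).der e x) atTop
          (𝓝 (∫ x in G.interval e, φ x * v.der e x)) := by
  classical
  choose c hc using fun n => (u n).continuous_vertex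
  -- Vertices at infinity, isolated vertices and those meeting only edges of length zero may carry
  -- unbounded values. Truncation discards these and leaves unchanged every value controlled by B.
  let c' : ℕ → V → ℂ := fun n a => if ‖c n a‖ ≤ B then c n a else 0
  have hc'B : ∀ n, c' n ∈ Metric.closedBall (0 : V → ℂ) B := fun n => by
    rw [mem_closedBall_zero_iff, pi_norm_le_iff_of_nonneg hB0]
    intro a
    by_cases h : ‖c n a‖ ≤ B
    · simp [c', h]
    · simp [c', h, hB0]
  have hc'eq : ∀ n a, ‖c n a‖ ≤ B → c' n a = c n a := fun n a h => by simp [c', h]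
  obtain ⟨c₀, -, k₀, hk₀, hlim₀⟩ := tendsto_subseq_of_bounded Metric.isBounded_closedBall hc'B
  have hmemend : ∀ e, G.length e ≠ ⊤ → (G.length e).toReal ∈ G.interval e := fun e he => by
    rw [interval_of_ne_top he]; exact ⟨ENNReal.toReal_nonneg, le_rfl⟩
  obtain ⟨k₁, hk₁, hP⟩ := exists_common_subseq
    (P := fun e k => ∃ w, MemLp w 2 (volume.restrict (G.interval e)) ∧
      ∀ φ, MemLp φ 2 (volume.restrict (G.interval e)) →
        Tendsto (fun n => ∫ x in G.interval e, φ x * (u (k₀ (k n))).der e x) atTop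
          (𝓝 (∫ x in G.interval e, φ x * w x)))
    (fun e k _ => by
      obtain ⟨j, hj, w, hw, h⟩ := exists_subseq_tendsto_integral_mul (C := B)
        (fun n => (u (k₀ (k n))).memLp_der e) (fun n => le_trans
          (Finset.single_le_sum (f := fun e => ∫ x in G.interval e, ‖(u (k₀ (k n))).der e x‖ ^ 2)
            (fun _ _ => integral_nonneg fun _ => sq_nonneg _) (Finset.mem_univ e))
          (hkin (k₀ (k n))))
      exact ⟨j, hj, w, hw, h⟩)
    (fun e k j ⟨w, hw, h⟩ hj => ⟨w, hw, fun φ hφ => (h φ hφ).comp hj.tendsto_atTop⟩)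
  choose w' hw' hlim' using hP
  -- Extension by zero makes the primitive of w a continuous function on the whole real line.
  let w : E → ℝ → ℂ := fun e => (G.interval e).indicator (w' e)
  have hww' : ∀ e, ∀ x ∈ G.interval e, w e x = w' e x := fun e x hx => indicator_of_mem hx _
  have hw2 : ∀ e, MemLp (w e) 2 := fun e =>
    (memLp_indicator_iff_restrict (measurableSet_interval e)).2 (hw' e)
  have hwlim : ∀ e φ, MemLp φ 2 (volume.restrict (G.interval e)) →
      Tendsto (fun n => ∫ x in G.interval e, φ x * (u (k₀ (k₁ n))).der e x) atTop
        (𝓝 (∫ x in G.interval e, φ x * w e x)) := by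
    intro e φ hφ
    rw [setIntegral_congr_fun (measurableSet_interval e)
      (fun x hx => by simp only [hww' e x hx] : EqOn _ (fun x => φ x * w' e x) _)]
    exact hlim' e φ hφ
  have hwi : ∀ e a b, IntervalIntegrable (w e) volume a b := fun e a b =>
    intervalIntegrable_iff.2 (by
      rw [uIoc]; exact ((hw2 e).mono_measure Measure.restrict_le_self).integrable one_le_two)
  have hc₀lim : ∀ a, Tendsto (fun n => c' (k₀ (k₁ n)) a) atTop (𝓝 (c₀ a)) := fun a =>
    (tendsto_pi_nhds.1 hlim₀ a).comp hk₁.tendsto_atTop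
  -- The limit is rebuilt from the limiting vertex values and the weak limit of the derivatives.
  let f : E → ℝ → ℂ := fun e x => c₀ (G.src e) + ∫ t in (0 : ℝ)..x, w e t
  have hfcont : ∀ e, Continuous (f e) := fun e =>
    continuous_const.add (intervalIntegral.continuous_primitive (hwi e) 0)
  have hptw : ∀ e, G.length e ≠ 0 → ∀ x ∈ G.interval e,
      Tendsto (fun n => (u (k₀ (k₁ n))).toFun e x) atTop (𝓝 (f e x)) := by
    intro e he x hx
    have hsub := Icc_subset_interval (zero_mem_interval (G := G) e) hx
    have hφ : MemLp ((Ioc 0 x).indicator fun _ => (1 : ℂ)) 2 (volume.restrict (G.interval e)) :=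
      memLp_indicator_const 2 measurableSet_Ioc 1 (Or.inr (ne_top_of_le_ne_top (by simp)
        (Measure.restrict_apply_le _ (Ioc 0 x))))
    have h1 := hwlim e _ hφ
    simp only [integral_indicator_one_mul hx.1 hsub] at h1
    refine ((hc₀lim (G.src e)).add h1).congr fun n => ?_
    have h0 := ((hc (k₀ (k₁ n))) e).1
    rw [hc'eq _ _ (by rw [← h0]; exact hB _ e he 0 (zero_mem_interval e)), ← h0,
      ← (u (k₀ (k₁ n))).sub_eq_integral (zero_mem_interval e) hx hx.1]
    ring
  have hsq : ∀ e, Integrable (fun x => ‖f e x‖ ^ 2) (volume.restrict (G.interval e)) := by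
    intro e
    by_cases he : G.length e = 0
    · simp [restrict_interval_of_eq_zero he]
    -- Fatou's lemma, with the mass bound m.
    · refine integrable_of_tendsto (G := fun n x => ‖(u (k₀ (k₁ n))).toFun e x‖ ^ 2)
        ((ae_restrict_mem (measurableSet_interval e)).mono fun x hx => ((hptw e he x hx).norm.pow 2))
        (fun n => ((u _).integrableOn_sq e).aestronglyMeasurable) ?_
      refine ne_top_of_le_ne_top (ENNReal.ofReal_ne_top (r := m))
        (liminf_le_of_frequently_le' (Frequently.of_forall fun n => ?_))
      rw [← ofReal_integral_norm_eq_lintegral_enorm ((u _).integrableOn_sq e)]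
      refine ENNReal.ofReal_le_ofReal (le_trans ?_ (hmass (k₀ (k₁ n))))
      simp only [norm_pow, norm_norm]
      exact Finset.single_le_sum (f := fun e => ∫ x in G.interval e, ‖(u (k₀ (k₁ n))).toFun e x‖ ^ 2)
        (fun _ _ => integral_nonneg fun _ => sq_nonneg _) (Finset.mem_univ e)
  have hweak : ∀ e, HasWeakDerivOn (f e) (w e) (G.interval e) := by
    intro e η hη hcs hts
    by_cases he : G.length e = 0
    · simp [restrict_interval_of_eq_zero he]
    have hηd : Continuous (deriv η) := hη.continuous_deriv (by simp)
    have h1 : Tendsto (fun n => ∫ x in G.interval e, deriv η x • (u (k₀ (k₁ n))).toFun e x) atTop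
        (𝓝 (∫ x in G.interval e, deriv η x • f e x)) := by
      refine tendsto_integral_of_dominated_convergence (fun x => ‖deriv η x‖ * B) (fun n => ?_) ?_
        (fun n => ?_) ?_
      · exact hηd.aestronglyMeasurable.fun_smul ((u _).memLp e).aestronglyMeasurable
      · exact ((hηd.integrable_of_hasCompactSupport hcs.deriv).norm.mul_const B).integrableOn
      · refine (ae_restrict_mem (measurableSet_interval e)).mono fun x hx => ?_
        rw [norm_smul]
        exact mul_le_mul_of_nonneg_left (hB _ e he x hx) (norm_nonneg _)
      · exact (ae_restrict_mem (measurableSet_interval e)).mono fun x hx =>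
          (hptw e he x hx).const_smul _
    have h2 := hwlim e (fun x => (η x : ℂ)) ((Complex.continuous_ofReal.comp
      hη.continuous).memLp_of_hasCompactSupport (hcs.comp_left Complex.ofReal_zero))
    simp only [← Complex.real_smul] at h2
    refine tendsto_nhds_unique h1 (h2.neg.congr fun n => ?_)
    exact ((u (k₀ (k₁ n))).hasWeakDeriv e η hη hcs hts).symm
  refine ⟨k₀ ∘ k₁, hk₀.comp hk₁, ⟨f, w, fun e => (hfcont e).continuousOn, ⟨c₀, fun e => ⟨?_, ?_⟩⟩,
    fun e => ?_, fun e => (hw2 e).restrict _, hweak⟩, hptw, hwlim⟩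
  · simp [f]
  · intro he
    by_cases h0 : G.length e = 0
    -- On an edge of length zero both ends share their value for every n, so the truncated values
    -- agree as well.
    · have : f e (G.length e).toReal = c₀ (G.src e) := by simp [f, h0]
      rw [this]
      refine tendsto_nhds_unique (hc₀lim (G.src e)) ((hc₀lim (G.tgt e)).congr fun n => ?_)
      have h1 := (hc (k₀ (k₁ n)) e).1
      have h2 := (hc (k₀ (k₁ n)) e).2 he
      rw [h0, ENNReal.toReal_zero] at h2
      simp only [c', ← h1, ← h2]
    · refine tendsto_nhds_unique (hptw e h0 _ (hmemend e he)) ((hc₀lim (G.tgt e)).congr fun n => ?_)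
      have h2 := (hc (k₀ (k₁ n)) e).2 he
      rw [h2, hc'eq]
      rw [← h2]
      exact hB _ e h0 _ (hmemend e he)
  · exact (memLp_two_iff_integrable_sq_norm
      (hfcont e).aestronglyMeasurable).2 (hsq e)

end MetricGraph

/-! ### Cutting at distance R, rescaling, and the energy balance in the weak limit. -/

lemma setIntegral_eq_add_inter_Ioi {h : ℝ → ℝ} {I : Set ℝ} (hh : IntegrableOn h I) (R : ℝ) :
    ∫ x in I, h x = (∫ x in I ∩ Iic R, h x) + ∫ x in I ∩ Ioi R, h x := by
  rw [← integral_inter_add_sdiff measurableSet_Iic hh, sdiff_eq, compl_Iic]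

lemma tendsto_setIntegral_inter_Iic {h : ℝ → ℝ} {I : Set ℝ} (hh : IntegrableOn h I) :
    Tendsto (fun R => ∫ x in I ∩ Iic R, h x) atTop (𝓝 (∫ x in I, h x)) := by
  have := (aecover_Iic (μ := volume.restrict I)
    (tendsto_id (α := ℝ) (x := atTop))).integral_tendsto_of_countably_generated hh
  refine this.congr fun R => ?_
  rw [Measure.restrict_restrict measurableSet_Iic, inter_comm, id]

/-- The square of the `L²` norm is bounded below by its tangent. -/
lemma tangent_le_integral_sq_norm {μ : Measure ℝ} {g w : ℝ → ℂ} (hg : MemLp g 2 μ)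
    (hw : MemLp w 2 μ) :
    2 * (∫ x, (starRingEnd ℂ) (w x) * g x ∂μ).re - ∫ x, ‖w x‖ ^ 2 ∂μ ≤ ∫ x, ‖g x‖ ^ 2 ∂μ := by
  have hg2 := (memLp_two_iff_integrable_sq_norm hg.aestronglyMeasurable).1 hg
  have hw2 := (memLp_two_iff_integrable_sq_norm hw.aestronglyMeasurable).1 hw
  have hwc : MemLp (fun x => (starRingEnd ℂ) (w x)) 2 μ := hw.star
  have hi : Integrable (fun x => (starRingEnd ℂ) (w x) * g x) μ := hwc.integrable_mul hg
  have hre : (∫ x, (starRingEnd ℂ) (w x) * g x ∂μ).re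
      = ∫ x, ((starRingEnd ℂ) (w x) * g x).re ∂μ := (integral_re hi).symm
  have hir : Integrable (fun x => 2 * ((starRingEnd ℂ) (w x) * g x).re) μ := hi.re.const_mul 2
  rw [hre, ← integral_const_mul, ← integral_sub hir hw2]
  refine integral_mono (hir.sub hw2) hg2 fun x => ?_
  have h1 : ‖g x‖ ^ 2 = (g x).re * (g x).re + (g x).im * (g x).im := by
    rw [Complex.sq_norm, Complex.normSq_apply]
  have h2 : ‖w x‖ ^ 2 = (w x).re * (w x).re + (w x).im * (w x).im := by
    rw [Complex.sq_norm, Complex.normSq_apply]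
  simp only [h1, h2, Complex.mul_re, Complex.conj_re, Complex.conj_im]
  nlinarith [sq_nonneg ((g x).re - (w x).re), sq_nonneg ((g x).im - (w x).im)]

namespace MetricGraph

variable {V E : Type*} {G : MetricGraph V E}

namespace H1

/-- Real multiples of a function in `H¹(G)`. -/
noncomputable def smul (t : ℝ) (u : G.H1) : G.H1 where
  toFun e x := t • u.toFun e x
  der e x := t • u.der e x
  continuousOn e := (u.continuousOn e).const_smul t
  continuous_vertex := by
    obtain ⟨c, hc⟩ := u.continuous_vertex
    exact ⟨fun a => t • c a, fun e => ⟨by rw [(hc e).1], fun h => by rw [(hc e).2 h]⟩⟩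
  memLp e := (u.memLp e).const_smul t
  memLp_der e := (u.memLp_der e).const_smul t
  hasWeakDeriv e η hη hcs hts := by
    simp only [smul_comm _ t, integral_smul]
    rw [u.hasWeakDeriv e η hη hcs hts, smul_neg]

end H1

/-- The bounded part of an edge has finite measure, so uniformly bounded functions converge there by
domination: no mass is lost at finite distance. -/
lemma tendsto_integral_comp_norm {u : ℕ → ℝ → ℂ} {v : ℝ → ℂ} {h : ℝ → ℝ} {B R : ℝ} {e : E}
    (hh : Continuous h) (hu : ∀ n, ContinuousOn (u n) (G.interval e))
    (hB : G.length e ≠ 0 → ∀ n, ∀ x ∈ G.interval e, ‖u n x‖ ≤ B)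
    (hlim : G.length e ≠ 0 → ∀ x ∈ G.interval e, Tendsto (fun n => u n x) atTop (𝓝 (v x))) :
    Tendsto (fun n => ∫ x in G.interval e ∩ Iic R, h ‖u n x‖) atTop
      (𝓝 (∫ x in G.interval e ∩ Iic R, h ‖v x‖)) := by
  by_cases he : G.length e = 0
  · have : volume.restrict (G.interval e ∩ Iic R) = 0 := by
      rw [Measure.restrict_eq_zero]
      exact measure_mono_null inter_subset_left
        (Measure.restrict_eq_zero.1 (restrict_interval_of_eq_zero he))
    simp [this]
  have hms : MeasurableSet (G.interval e ∩ Iic R) :=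
    (measurableSet_interval e).inter measurableSet_Iic
  obtain ⟨C, hC⟩ := (isCompact_Icc (a := (0 : ℝ)) (b := B)).exists_bound_of_continuousOn
    hh.continuousOn
  refine tendsto_integral_of_dominated_convergence (fun _ => C) (fun n => ?_) ?_ (fun n => ?_) ?_
  · exact (hh.comp_continuousOn ((hu n).mono inter_subset_left).norm).aestronglyMeasurable hms
  · have hfin : volume (G.interval e ∩ Iic R) < ⊤ :=
      (measure_mono (t := Icc 0 R) fun x hx => ⟨hx.1.1, hx.2⟩).trans_lt (by simp)
    rw [integrable_const_iff]
    right
    exact ⟨by simpa using hfin⟩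
  · exact (ae_restrict_mem hms).mono fun x hx => hC _ ⟨norm_nonneg _, hB he n x hx.1⟩
  · exact (ae_restrict_mem hms).mono fun x hx => (hh.tendsto _).comp (hlim he x hx.1).norm

variable [Fintype E]

lemma mass_smul (t : ℝ) (u : G.H1) : mass (u.smul t) = t ^ 2 * mass u := by
  simp only [mass, H1.smul, norm_smul, mul_pow, integral_const_mul, Finset.mul_sum,
    Real.norm_eq_abs, sq_abs]

lemma energy_smul {p t : ℝ} (ht : 0 ≤ t) (u : G.H1) :
    energy p (u.smul t) = t ^ 2 * (1 / 2 * kinetic u) - t ^ p * (1 / p * potential p u) := by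
  have h1 : kinetic (u.smul t) = t ^ 2 * kinetic u := by
    simp only [kinetic, H1.smul, norm_smul, mul_pow, integral_const_mul, Finset.mul_sum,
      Real.norm_eq_abs, sq_abs]
  have h2 : potential p (u.smul t) = t ^ p * potential p u := by
    simp only [potential, H1.smul, norm_smul, Real.norm_of_nonneg ht,
      Real.mul_rpow ht (norm_nonneg _), integral_const_mul, Finset.mul_sum]
  rw [energy_eq, h1, h2]
  ring

lemma potential_nonneg (p : ℝ) (u : G.H1) : 0 ≤ potential p u :=
  Finset.sum_nonneg fun _ _ => integral_nonneg fun _ => Real.rpow_nonneg (norm_nonneg _) _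

/-- Covers the case where all the mass escapes, in which the weak limit cannot be rescaled to mass
`μ`. -/
lemma energy_nonneg_of_mass_eq_zero {p : ℝ} (hp₂ : 2 < p) {u : G.H1} (hu : mass u = 0) :
    0 ≤ energy p u := by
  have hpot : potential p u = 0 := by
    refine Finset.sum_eq_zero fun e _ => ?_
    have h0 := (Finset.sum_eq_zero_iff_of_nonneg (fun _ _ => integral_nonneg fun _ =>
      sq_nonneg _)).1 hu e (Finset.mem_univ e)
    obtain ⟨B, hB⟩ := u.exists_bound e
    have h1 := (integrableOn_rpow_of_bound hp₂ (measurableSet_interval e) (u.memLp e) hB).2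
    rw [h0, mul_zero] at h1
    exact le_antisymm h1 (integral_nonneg fun _ => Real.rpow_nonneg (norm_nonneg _) _)
  rw [energy_eq, hpot]
  linarith [kinetic_nonneg u]

/-- Raising the mass by a factor lowers the energy at least by the same factor. -/
lemma mul_le_energy {p μ I : ℝ} (hp₂ : 2 < p) (hI : ∀ v ∈ G.H1mu μ, I ≤ energy p v)
    (u : G.H1) (hu : 0 < mass u) (huμ : mass u ≤ μ) : mass u / μ * I ≤ energy p u := by
  have hμ : 0 < μ := hu.trans_le huμ
  set t := √(μ / mass u) with ht
  have ht1 : 1 ≤ t := Real.one_le_sqrt.2 ((one_le_div hu).2 huμ)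
  have ht2 : t ^ 2 = μ / mass u := Real.sq_sqrt (by positivity)
  have hm : mass (u.smul t) = μ := by rw [mass_smul, ht2]; field_simp
  have h1 := hI (u.smul t) hm
  rw [energy_smul (by linarith)] at h1
  have h2 : t ^ 2 ≤ t ^ p := by
    rw [← Real.rpow_two]; exact Real.rpow_le_rpow_of_exponent_le ht1 hp₂.le
  have h3 : t ^ 2 * (1 / p * potential p u) ≤ t ^ p * (1 / p * potential p u) := by
    have := potential_nonneg p u
    have p0 : 0 < p := by linarith
    gcongr
  have h4 : I ≤ μ / mass u * energy p u := by
    rw [energy_eq, ← ht2]; linarith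
  calc mass u / μ * I ≤ mass u / μ * (μ / mass u * energy p u) := by gcongr
    _ = energy p u := by field_simp

/-- The limit of the energies along a weakly convergent sequence is at least the energy of the weak
limit plus the least energy on the line at the mass that is lost. -/
lemma energy_add_lineLevel_le {p μ B I : ℝ} (hG : G.Noncompact) (hp₂ : 2 < p) (hp₆ : p < 6)
    {u : ℕ → G.H1} {v : G.H1} (hmass : ∀ n, mass (u n) = μ)
    (hB : ∀ n e, G.length e ≠ 0 → ∀ x ∈ G.interval e, ‖(u n).toFun e x‖ ≤ B)
    (hptw : ∀ e, G.length e ≠ 0 → ∀ x ∈ G.interval e,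
      Tendsto (fun n => (u n).toFun e x) atTop (𝓝 (v.toFun e x)))
    (hweak : ∀ e φ, MemLp φ 2 (volume.restrict (G.interval e)) →
      Tendsto (fun n => ∫ x in G.interval e, φ x * (u n).der e x) atTop
        (𝓝 (∫ x in G.interval e, φ x * v.der e x)))
    (hI : Tendsto (fun n => energy p (u n)) atTop (𝓝 I)) :
    mass v ≤ μ ∧ energy p v + lineLevel p (μ - mass v) ≤ I := by
  have p0 : 0 < p := by linarith
  set C := √(2 / p * B ^ (p - 2)) / 2 with hC
  have hms : ∀ (e : E) (R : ℝ), MeasurableSet (G.interval e ∩ Iic R) := fun e R =>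
    (measurableSet_interval e).inter measurableSet_Iic
  have hsqlim : ∀ R : ℝ, Tendsto (fun n => ∑ e, ∫ x in G.interval e ∩ Iic R, ‖(u n).toFun e x‖ ^ 2)
      atTop (𝓝 (∑ e, ∫ x in G.interval e ∩ Iic R, ‖v.toFun e x‖ ^ 2)) := fun R =>
    tendsto_finsetSum _ fun e _ => tendsto_integral_comp_norm (h := fun t => t ^ 2) (by fun_prop)
      (fun n => (u n).continuousOn e) (fun he n => hB n e he) (hptw e)
  have hplim : ∀ R : ℝ, Tendsto (fun n => ∑ e, ∫ x in G.interval e ∩ Iic R, ‖(u n).toFun e x‖ ^ p)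
      atTop (𝓝 (∑ e, ∫ x in G.interval e ∩ Iic R, ‖v.toFun e x‖ ^ p)) := fun R =>
    tendsto_finsetSum _ fun e _ => tendsto_integral_comp_norm (h := fun t => t ^ p)
      (Real.continuous_rpow_const p0.le)
      (fun n => (u n).continuousOn e) (fun he n => hB n e he) (hptw e)
  have hmle : ∀ R : ℝ, ∑ e, ∫ x in G.interval e ∩ Iic R, ‖v.toFun e x‖ ^ 2 ≤ μ := fun R =>
    le_of_tendsto' (hsqlim R) fun n => by
      rw [← hmass n]
      exact Finset.sum_le_sum fun e _ => setIntegral_mono_set ((u n).integrableOn_sq e)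
        (ae_of_all _ fun _ => sq_nonneg _) (LE.le.eventuallyLE inter_subset_left)
  have hRm : Tendsto (fun R : ℝ => ∑ e, ∫ x in G.interval e ∩ Iic R, ‖v.toFun e x‖ ^ 2) atTop
      (𝓝 (mass v)) := tendsto_finsetSum _ fun e _ =>
    tendsto_setIntegral_inter_Iic (v.integrableOn_sq e)
  have hRp : Tendsto (fun R : ℝ => ∑ e, ∫ x in G.interval e ∩ Iic R, ‖v.toFun e x‖ ^ p) atTop
      (𝓝 (potential p v)) := tendsto_finsetSum _ fun e _ =>
    tendsto_setIntegral_inter_Iic (v.integrableOn_rpow e hp₂)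
  have hRk : Tendsto (fun R : ℝ => ∑ e, ∫ x in G.interval e ∩ Iic R, ‖v.der e x‖ ^ 2) atTop
      (𝓝 (kinetic v)) := tendsto_finsetSum _ fun e _ =>
    tendsto_setIntegral_inter_Iic (v.integrableOn_der_sq e)
  have hRend : Tendsto (fun R : ℝ => ∑ e with G.length e = ⊤, ‖v.toFun e R‖ ^ 2) atTop (𝓝 0) := by
    have : Tendsto (fun R : ℝ => ∑ e with G.length e = ⊤, ‖v.toFun e R‖ ^ 2) atTop
        (𝓝 (∑ e with G.length e = ⊤, (0 : ℝ) ^ 2)) :=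
      tendsto_finsetSum _ fun e he =>
        (v.tendsto_norm_atTop (by simpa using he)).pow 2
    simpa using this
  refine ⟨le_of_tendsto' hRm hmle, ?_⟩
  have hcont := continuous_lineLevel hp₂ hp₆
  have hRlim := (((hRk.const_mul (1 / 2)).sub (hRp.const_mul (1 / p))).add
    ((hcont.tendsto _).comp (hRm.const_sub μ))).sub (hRend.const_mul C)
  rw [mul_zero, sub_zero, ← energy_eq] at hRlim
  -- It remains to treat a fixed R beyond all finite edge lengths, letting n tend to infinity first.
  refine le_of_tendsto hRlim ?_
  obtain ⟨R₀, hR₀⟩ : ∃ R₀ : ℝ, ∀ e, (G.length e).toReal ≤ R₀ :=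
    ⟨∑ e, (G.length e).toReal, fun e => Finset.single_le_sum (f := fun e => (G.length e).toReal)
      (fun _ _ => ENNReal.toReal_nonneg) (Finset.mem_univ e)⟩
  filter_upwards [Ici_mem_atTop (max R₀ 0)] with R hR
  have hR0 : 0 ≤ R := (le_max_right _ _).trans hR
  have hRlen : ∀ e, (G.length e).toReal ≤ R := fun e =>
    (hR₀ e).trans ((le_max_left _ _).trans hR)
  let φ : E → ℝ → ℂ := fun e =>
    (G.interval e ∩ Iic R).indicator fun x => (starRingEnd ℂ) (v.der e x)
  have hφ : ∀ e, MemLp (φ e) 2 (volume.restrict (G.interval e)) := fun e =>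
    MemLp.indicator (hms e R) (v.memLp_der e).star
  have hφint : ∀ e (g : ℝ → ℂ), ∫ x in G.interval e, φ e x * g x =
      ∫ x in G.interval e ∩ Iic R, (starRingEnd ℂ) (v.der e x) * g x := by
    intro e g
    simp only [φ, ← indicator_mul_left]
    rw [setIntegral_indicator (hms e R), ← inter_assoc, inter_self]
  have hself : ∀ e, (∫ x in G.interval e ∩ Iic R, (starRingEnd ℂ) (v.der e x) * v.der e x).re
      = ∫ x in G.interval e ∩ Iic R, ‖v.der e x‖ ^ 2 := by
    intro e
    have : ∀ x, (starRingEnd ℂ) (v.der e x) * v.der e x = ((‖v.der e x‖ ^ 2 : ℝ) : ℂ) := fun x => by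
      rw [mul_comm, Complex.mul_conj, Complex.sq_norm]
    simp only [this, integral_complex_ofReal, Complex.ofReal_re]
  -- The tangent to the squared norm at v' is affine in u', hence converges under weak convergence.
  -- This gives lower semicontinuity of the kinetic term within distance R.
  have hklim : Tendsto (fun n => ∑ e, (2 * (∫ x in G.interval e, φ e x * (u n).der e x).re -
      ∫ x in G.interval e ∩ Iic R, ‖v.der e x‖ ^ 2)) atTop
      (𝓝 (∑ e, ∫ x in G.interval e ∩ Iic R, ‖v.der e x‖ ^ 2)) := by
    refine tendsto_finsetSum _ fun e _ => ?_
    have h1 := (Complex.continuous_re.tendsto _).comp (hweak e (φ e) (hφ e))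
    have h2 := (h1.const_mul 2).sub_const (∫ x in G.interval e ∩ Iic R, ‖v.der e x‖ ^ 2)
    rw [hφint, hself] at h2
    have e2 : 2 * (∫ x in G.interval e ∩ Iic R, ‖v.der e x‖ ^ 2)
      - ∫ x in G.interval e ∩ Iic R, ‖v.der e x‖ ^ 2
      = ∫ x in G.interval e ∩ Iic R, ‖v.der e x‖ ^ 2 := by ring
    rwa [e2] at h2
  have hendlim : Tendsto (fun n => ∑ e with G.length e = ⊤, ‖(u n).toFun e R‖ ^ 2) atTop
      (𝓝 (∑ e with G.length e = ⊤, ‖v.toFun e R‖ ^ 2)) := by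
    refine tendsto_finsetSum _ fun e he => ?_
    have he' : G.length e = ⊤ := by simpa using he
    exact (hptw e (by simp [he']) R (by rw [interval_of_eq_top he']; exact hR0)).norm.pow 2
  have hnlim := (((hklim.const_mul (1 / 2)).sub ((hplim R).const_mul (1 / p))).add
    ((hcont.tendsto _).comp ((hsqlim R).const_sub μ))).sub (hendlim.const_mul C)
  refine le_of_tendsto_of_tendsto' hnlim hI fun n => ?_
  have htail := lineLevel_sub_le_tail hG hp₂ hp₆ (u n) (hB n) hR0 fun e _ => hRlen e
  have hm : mass (u n) = (∑ e, ∫ x in G.interval e ∩ Iic R, ‖(u n).toFun e x‖ ^ 2)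
      + ∑ e, ∫ x in G.interval e ∩ Ioi R, ‖(u n).toFun e x‖ ^ 2 := by
    rw [mass, ← Finset.sum_add_distrib]
    exact Finset.sum_congr rfl fun e _ => setIntegral_eq_add_inter_Ioi ((u n).integrableOn_sq e) R
  have hk : kinetic (u n) = (∑ e, ∫ x in G.interval e ∩ Iic R, ‖(u n).der e x‖ ^ 2)
      + ∑ e, ∫ x in G.interval e ∩ Ioi R, ‖(u n).der e x‖ ^ 2 := by
    rw [kinetic, ← Finset.sum_add_distrib]
    exact Finset.sum_congr rfl fun e _ =>
      setIntegral_eq_add_inter_Ioi ((u n).integrableOn_der_sq e) R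
  have hpo : potential p (u n) = (∑ e, ∫ x in G.interval e ∩ Iic R, ‖(u n).toFun e x‖ ^ p)
      + ∑ e, ∫ x in G.interval e ∩ Ioi R, ‖(u n).toFun e x‖ ^ p := by
    rw [potential, ← Finset.sum_add_distrib]
    exact Finset.sum_congr rfl fun e _ =>
      setIntegral_eq_add_inter_Ioi ((u n).integrableOn_rpow e hp₂) R
  have hkin : ∑ e, (2 * (∫ x in G.interval e, φ e x * (u n).der e x).re -
      ∫ x in G.interval e ∩ Iic R, ‖v.der e x‖ ^ 2) ≤
      ∑ e, ∫ x in G.interval e ∩ Iic R, ‖(u n).der e x‖ ^ 2 := by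
    refine Finset.sum_le_sum fun e _ => ?_
    rw [hφint]
    exact tangent_le_integral_sq_norm
      (((u n).memLp_der e).mono_measure (Measure.restrict_mono inter_subset_left le_rfl))
      ((v.memLp_der e).mono_measure (Measure.restrict_mono inter_subset_left le_rfl))
  have hmt : μ - ∑ e, ∫ x in G.interval e ∩ Iic R, ‖(u n).toFun e x‖ ^ 2
      = ∑ e, ∫ x in G.interval e ∩ Ioi R, ‖(u n).toFun e x‖ ^ 2 := by
    rw [← hmass n, hm]; ring
  simp only [Function.comp_apply]
  rw [← hC] at htail
  rw [hmt, energy_eq, hk, hpo]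
  linarith

end MetricGraph

/-! ### Existence of ground states. -/

theorem theorem6p2 {V E : Type*} [Fintype V] [Fintype E] (G : MetricGraph V E)
    (hG : G.Noncompact) (p : ℝ) (hp₂ : 2 < p) (hp₆ : p < 6) (μ : ℝ) (hμ : 0 < μ)
    (h : G.groundEnergy p μ < (solitonEnergy p μ : EReal)) :
    ∃ u : G.H1, G.IsGroundState p μ u := by
  obtain ⟨v₀, hv₀, hlt⟩ : ∃ v ∈ G.H1mu μ, MetricGraph.energy p v < solitonEnergy p μ := by
    rw [MetricGraph.groundEnergy] at h
    simp only [iInf_lt_iff, EReal.coe_lt_coe_iff] at h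
    obtain ⟨v, hv, hlt⟩ := h
    exact ⟨v, hv, hlt⟩
  rw [solitonEnergy_eq hp₂ hp₆ hμ] at hlt
  have hbdd := G.bddBelow_energy hp₂ hp₆ hμ.le
  set I := sInf (MetricGraph.energy p '' G.H1mu μ) with hIdef
  have hIle : ∀ v ∈ G.H1mu μ, I ≤ MetricGraph.energy p v := fun v hv => csInf_le hbdd (mem_image_of_mem _ hv)
  have hIlt : I < lineLevel p μ := (hIle v₀ hv₀).trans_lt hlt
  obtain ⟨s, _, hslim, hsmem⟩ := exists_seq_tendsto_sInf ⟨_, mem_image_of_mem (MetricGraph.energy p) hv₀⟩ hbdd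
  choose u hu hus using hsmem
  obtain ⟨C, hC⟩ := hslim.bddAbove_range
  obtain ⟨B, hB0, hB⟩ := G.exists_bound_of_energy_le hp₂ hp₆ hμ.le C
  have hbd := fun n => hB (u n) (hu n) (by rw [hus n]; exact hC (mem_range_self n))
  obtain ⟨k, hk, v, hptw, hweak⟩ := MetricGraph.exists_subseq_tendsto hB0 (fun n => (hbd n).1)
    (fun n => (hu n).le) (fun n => (hbd n).2)
  obtain ⟨hmle, hle⟩ := MetricGraph.energy_add_lineLevel_le (u := fun n => u (k n)) hG hp₂ hp₆
    (fun n => hu (k n)) (fun n => (hbd (k n)).2) hptw hweak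
    (by simpa only [hus, Function.comp_def] using hslim.comp hk.tendsto_atTop)
  -- Splitting `μ` into retained and lost mass would cost strictly more than I in total, so nothing
  -- is lost.
  have hmass : MetricGraph.mass v = μ := by
    by_contra hne
    have hmlt : MetricGraph.mass v < μ := lt_of_le_of_ne hmle hne
    have h1 : MetricGraph.mass v / μ * I ≤ MetricGraph.energy p v := by
      rcases (MetricGraph.mass_nonneg v).eq_or_lt with h0 | h0
      · rw [← h0, zero_div, zero_mul]
        exact MetricGraph.energy_nonneg_of_mass_eq_zero hp₂ h0.symm
      · exact MetricGraph.mul_le_energy hp₂ hIle v h0 hmle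
    have h2 := mul_lineLevel_le hp₂ hp₆ (m := μ - MetricGraph.mass v) (μ := μ) (by linarith)
      (by linarith [MetricGraph.mass_nonneg v]) hμ
    have h3 : (μ - MetricGraph.mass v) / μ * I < (μ - MetricGraph.mass v) / μ * lineLevel p μ :=
      mul_lt_mul_of_pos_left hIlt (div_pos (by linarith) hμ)
    have h4 : MetricGraph.mass v / μ * I + (μ - MetricGraph.mass v) / μ * I = I := by field_simp; ring
    linarith
  rw [hmass, sub_self, lineLevel_zero, add_zero] at hle
  exact ⟨v, hmass, le_antisymm
    (le_iInf₂ fun w hw => EReal.coe_le_coe_iff.2 (hle.trans (hIle w hw)))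
    (iInf₂_le v hmass)⟩
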